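/- **Theorem.** Let $K$ and $H$ be commutative locally compact Hausdorff hypergroups (in the sense of Jewett), with convolutions $\omega$, identities $e$ and involutions $x\mapsto\tilde x$. Let $K\times H$ be the product hypergroup: its convolution $\omega((x,x'),(y,y'))$ is the Radon product $\omega(x,y)\otimes\omega(x',y')$, its identity is $(e,e)$ and its involution is $(x,x')^{\sim}=(\tilde x,\tilde x')$. For a commutative hypergroup $K$ with Haar measure $m$ (Radon measures being normalised so that locally null Borel sets are null, so that $L^\infty(K)$ is taken modulo locally null functions), put $T_xf(y)=\int_K f\,d\omega(x,y)$ and let $$\widehat K=\Big\{\alpha\in C^b(K):\ \alpha\neq 0,\ \int_K\alpha\,d\omega(x,y)=\alpha(x)\alpha(y),\ \alpha(\tilde x)=\overline{\alpha(x)}\ \text{ for all } x,y\in K\Big\},$$ with the compact-open topology. For $\alpha\in\widehat K$, the hypergroup $K$ is called $\alpha$-amenable if there is a bounded linear functional $M$ on $L^\infty(K)$ with $M(\alpha)=1$ and $M(T_xf)=\alpha(x)M(f)$ for all $f\in L^\infty(K)$ and $x\in K$. For $\alpha\in\widehat K$ and $\beta\in\widehat H$ write $(\alpha\otimes\beta)(x,y)=\alpha(x)\beta(y)$.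 Then: (i) $(\alpha,\beta)\mapsto\alpha\otimes\beta$ is a homeomorphism from $\widehat K\times\widehat H$ onto $\widehat{K\times H}$, where the duals carry the compact-open topologies. (ii) For all $\alpha\in\widehat K$ and $\beta\in\widehat H$, the hypergroup $K\times H$ is $(\alpha\otimes\beta)$-amenable if and only if $K$ is $\alpha$-amenable and $H$ is $\beta$-amenable. -/

import Mathlib

open MeasureTheory Filter Topology Set
open scoped CompactlySupported BoundedContinuousFunction ENNReal ComplexConjugate


noncomputable section

/-! ### The Radon product of two measures -/

section RadonProduct

variable {X Y : Type*} [TopologicalSpace X] [T2Space X] [LocallyCompactSpace X]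
  [MeasurableSpace X] [BorelSpace X] [TopologicalSpace Y] [T2Space Y] [LocallyCompactSpace Y]
  [MeasurableSpace Y] [BorelSpace Y]

theorem integrable_slice (ν : Measure Y) [IsFiniteMeasureOnCompacts ν] (f : C_c(X × Y, ℝ)) (x : X) :
    Integrable (fun y => f (x, y)) ν := by
  refine Continuous.integrable_of_hasCompactSupport (by fun_prop) ?_
  refine HasCompactSupport.intro (f.hasCompactSupport.isCompact.image continuous_snd) ?_
  intro y hy
  by_contra h
  exact hy ⟨(x, y), subset_tsupport _ h, rfl⟩

theorem integrable_marginal (μ : Measure X) (ν : Measure Y) [IsFiniteMeasureOnCompacts μ]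
    [IsFiniteMeasureOnCompacts ν] (f : C_c(X × Y, ℝ)) :
    Integrable (fun x => ∫ y, f (x, y) ∂ν) μ := by
  have hk := f.hasCompactSupport.isCompact.image (continuous_snd (X := X) (Y := Y))
  refine Continuous.integrable_of_hasCompactSupport ?_ ?_
  · rw [← continuousOn_univ]
    refine continuousOn_integral_of_compact_support (f := fun x y => f (x, y)) hk ?_ ?_
    · exact (f.continuous.continuousOn)
    · intro p y _ hy
      by_contra h
      exact hy ⟨(p, y), subset_tsupport _ h, rfl⟩
  · refine HasCompactSupport.intro
      (f.hasCompactSupport.isCompact.image (continuous_fst (X := X) (Y := Y))) ?_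
    intro x hx
    have : ∀ y, f (x, y) = 0 := by
      intro y
      by_contra h
      exact hx ⟨(x, y), subset_tsupport _ h, rfl⟩
    simp [this]

/-- The positive functional `f ↦ ∫∫ f(x, y) dν(y) dμ(x)` on `C_c(X × Y)`. -/
def radonProdFunctional (μ : Measure X) (ν : Measure Y) [IsFiniteMeasureOnCompacts μ]
    [IsFiniteMeasureOnCompacts ν] : C_c(X × Y, ℝ) →ₚ[ℝ] ℝ :=
  PositiveLinearMap.mk₀
    { toFun := fun f => ∫ x, ∫ y, f (x, y) ∂ν ∂μ
      map_add' := by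
        intro f g
        rw [← integral_add (integrable_marginal μ ν f) (integrable_marginal μ ν g)]
        refine integral_congr_ae (.of_forall fun x => ?_)
        exact integral_add (integrable_slice ν f x) (integrable_slice ν g x)
      map_smul' := by
        intro c f
        simp only [CompactlySupportedContinuousMap.coe_smul, Pi.smul_apply, smul_eq_mul,
          integral_const_mul, RingHom.id_apply] }
    (fun _ hf => integral_nonneg fun x => integral_nonneg fun y => hf (x, y))

theorem ae_mem_support (μ : Measure X) [μ.Regular] : ∀ᵐ x ∂μ, x ∈ μ.support :=
  Measure.support_mem_ae_of_regular

/-- A cutoff function on a locally compact Hausdorff space. -/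
theorem exists_cutoff {Z : Type*} [TopologicalSpace Z] [T2Space Z] [LocallyCompactSpace Z]
    {C U : Set Z} (hC : IsCompact C) (hU : IsOpen U) (hCU : C ⊆ U) :
    ∃ g : C_c(Z, ℝ), (∀ z ∈ C, g z = 1) ∧ (∀ z ∉ U, g z = 0) ∧ ∀ z, 0 ≤ g z ∧ g z ≤ 1 := by
  obtain ⟨f, h1, h2, h3, h4⟩ := exists_continuous_one_zero_of_isCompact hC hU.isClosed_compl
    (disjoint_compl_right_iff_subset.mpr hCU)
  exact ⟨⟨f, h3⟩, fun z hz => h1 hz, fun z hz => h2 hz, fun z => h4 z⟩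

theorem integral_swap_of_support (μ : Measure X) (ν : Measure Y) [μ.Regular] [ν.Regular] (hμ : IsCompact μ.support)
    (hν : IsCompact ν.support) {f : X → Y → ℝ} (hf : Continuous f.uncurry) :
    ∫ x, ∫ y, f x y ∂ν ∂μ = ∫ y, ∫ x, f x y ∂μ ∂ν := by
  obtain ⟨g, g1, -, -⟩ := exists_cutoff (hμ.prod hν) isOpen_univ (subset_univ _)
  have key := integral_integral_swap_of_hasCompactSupport (f := fun x y => f x y * g (x, y))
    (μ := μ) (ν := ν) (by
      change Continuous fun p : X × Y => f.uncurry p * g p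
      fun_prop) (by
      change HasCompactSupport fun p : X × Y => f.uncurry p * g p
      exact g.hasCompactSupport.mul_left)
  convert key using 1
  · refine integral_congr_ae ?_
    filter_upwards [ae_mem_support μ] with x hx
    refine integral_congr_ae ?_
    filter_upwards [ae_mem_support ν] with y hy
    rw [g1 _ ⟨hx, hy⟩, mul_one]
  · refine integral_congr_ae ?_
    filter_upwards [ae_mem_support ν] with y hy
    refine integral_congr_ae ?_
    filter_upwards [ae_mem_support μ] with x hx
    rw [g1 _ ⟨hx, hy⟩, mul_one]

variable [MeasurableSpace (X × Y)] [BorelSpace (X × Y)]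

/-- The Radon product `μ ⊗ ν`: the Radon measure on the Borel sets of `X × Y` representing the
functional `f ↦ ∫∫ f(x, y) dν(y) dμ(x)`, `f ∈ C_c(X × Y)`. (Without countability assumptions the
Borel `σ`-algebra of `X × Y` can be larger than the product `σ`-algebra.) -/
def radonProd (μ : Measure X) (ν : Measure Y) [IsFiniteMeasureOnCompacts μ]
    [IsFiniteMeasureOnCompacts ν] : Measure (X × Y) :=
  RealRMK.rieszMeasure (radonProdFunctional μ ν)

instance regular_radonProd (μ : Measure X) (ν : Measure Y) [IsFiniteMeasureOnCompacts μ]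
    [IsFiniteMeasureOnCompacts ν] : (radonProd μ ν).Regular := by
  unfold radonProd; infer_instance

theorem integral_radonProd_cc (μ : Measure X) (ν : Measure Y) [IsFiniteMeasureOnCompacts μ]
    [IsFiniteMeasureOnCompacts ν] (f : C_c(X × Y, ℝ)) :
    ∫ p, f p ∂(radonProd μ ν) = ∫ x, ∫ y, f (x, y) ∂ν ∂μ :=
  RealRMK.integral_rieszMeasure _ f

theorem radonProd_open_le (μ : Measure X) (ν : Measure Y) [IsFiniteMeasureOnCompacts μ]
    [IsFiniteMeasureOnCompacts ν] {U : Set (X × Y)} (hU : IsOpen U) {c : ℝ≥0∞}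
    (h : ∀ g : C_c(X × Y, ℝ), (∀ z ∉ U, g z = 0) → (∀ z, 0 ≤ g z ∧ g z ≤ 1) →
      ENNReal.ofReal (∫ x, ∫ y, g (x, y) ∂ν ∂μ) ≤ c) :
    radonProd μ ν U ≤ c := by
  rw [hU.measure_eq_iSup_isCompact]
  refine iSup₂_le fun L hLU => iSup_le fun hL => ?_
  obtain ⟨g, g1, g2, g3⟩ := exists_cutoff hL hU hLU
  exact (RealRMK.rieszMeasure_le_of_eq_one _ (fun z => (g3 z).1) hL g1).trans (h g g2 g3)

variable (μ : Measure X) (ν : Measure Y) [IsProbabilityMeasure μ] [IsProbabilityMeasure ν]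

theorem isProbabilityMeasure_radonProd [μ.Regular] [ν.Regular] (hμ : IsCompact μ.support)
    (hν : IsCompact ν.support) : IsProbabilityMeasure (radonProd μ ν) := by
  constructor
  apply le_antisymm
  · refine radonProd_open_le μ ν isOpen_univ fun g _ hg => ?_
    rw [← ENNReal.ofReal_one]
    apply ENNReal.ofReal_le_ofReal
    calc ∫ x, ∫ y, g (x, y) ∂ν ∂μ ≤ ∫ x, (1 : ℝ) ∂μ := by
          refine integral_mono (integrable_marginal μ ν g) (integrable_const _) fun x => ?_
          calc ∫ y, g (x, y) ∂ν ≤ ∫ y, (1 : ℝ) ∂ν :=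
                integral_mono (integrable_slice ν g x) (integrable_const _) fun y => (hg _).2
            _ = 1 := by simp
      _ = 1 := by simp
  · obtain ⟨g, g1, -, g3⟩ := exists_cutoff (hμ.prod hν) isOpen_univ (subset_univ _)
    have h := RealRMK.le_rieszMeasure_tsupport_subset (radonProdFunctional μ ν) g3
      (subset_univ (tsupport g))
    have h1 : ∫ x, ∫ y, g (x, y) ∂ν ∂μ = 1 := by
      have : (fun x => ∫ y, g (x, y) ∂ν) =ᵐ[μ] fun _ => (1 : ℝ) := by
        filter_upwards [ae_mem_support μ] with x hx
        have : (fun y => g (x, y)) =ᵐ[ν] fun _ => (1 : ℝ) := by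
          filter_upwards [ae_mem_support ν] with y hy using g1 _ ⟨hx, hy⟩
        simp [integral_congr_ae this]
      simp [integral_congr_ae this]
    have h2 : radonProdFunctional μ ν g = 1 := h1
    rw [h2, ENNReal.ofReal_one] at h
    exact h

theorem support_radonProd [μ.Regular] [ν.Regular] (hμ : IsCompact μ.support)
    (hν : IsCompact ν.support) : (radonProd μ ν).support = μ.support ×ˢ ν.support := by
  apply subset_antisymm
  · refine Measure.support_subset_of_isClosed (hμ.prod hν).isClosed ?_
    rw [mem_ae_iff]
    refine le_antisymm (radonProd_open_le μ ν (hμ.prod hν).isClosed.isOpen_compl fun g hg _ => ?_)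
      bot_le
    have : (fun x => ∫ y, g (x, y) ∂ν) =ᵐ[μ] fun _ => (0 : ℝ) := by
      filter_upwards [ae_mem_support μ] with x hx
      have : (fun y => g (x, y)) =ᵐ[ν] fun _ => (0 : ℝ) := by
        filter_upwards [ae_mem_support ν] with y hy using hg _ (not_not.mpr ⟨hx, hy⟩)
      simp [integral_congr_ae this]
    simp [integral_congr_ae this]
  · rintro ⟨x, y⟩ ⟨hx, hy⟩
    rw [Measure.support_eq_forall_isOpen]
    intro U hxU hU
    obtain ⟨V, W, hV, hW, hxV, hyW, hVW⟩ := isOpen_prod_iff.mp hU x y hxU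
    obtain ⟨a, a1, a2, a3⟩ := exists_cutoff isCompact_singleton hV (singleton_subset_iff.mpr hxV)
    obtain ⟨b, b1, b2, b3⟩ := exists_cutoff isCompact_singleton hW (singleton_subset_iff.mpr hyW)
    have pa : 0 < ∫ s, a s ∂μ := by
      rw [integral_pos_iff_support_of_nonneg (fun s => (a3 s).1) a.integrable]
      refine (Measure.mem_support_iff_forall x).mp hx _ (a.continuous.isOpen_support.mem_nhds ?_)
      simp [a1 x rfl]
    have pb : 0 < ∫ s, b s ∂ν := by
      rw [integral_pos_iff_support_of_nonneg (fun s => (b3 s).1) b.integrable]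
      refine (Measure.mem_support_iff_forall y).mp hy _ (b.continuous.isOpen_support.mem_nhds ?_)
      simp [b1 y rfl]
    let g : C_c(X × Y, ℝ) :=
      ⟨⟨fun p => a p.1 * b p.2, by fun_prop⟩, by
        refine HasCompactSupport.intro
          (a.hasCompactSupport.isCompact.prod b.hasCompactSupport.isCompact) ?_
        rintro ⟨s, t⟩ hst
        by_contra h
        exact hst ⟨subset_tsupport _ (left_ne_zero_of_mul h),
          subset_tsupport _ (right_ne_zero_of_mul h)⟩⟩
    have hg : ∫ p, g p ∂(radonProd μ ν) = (∫ s, a s ∂μ) * ∫ t, b t ∂ν := by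
      rw [integral_radonProd_cc]
      change ∫ s, ∫ t, a s * b t ∂ν ∂μ = _
      simp only [integral_const_mul, integral_mul_const]
    by_contra hzero
    have h0 : radonProd μ ν U = 0 := by simpa using hzero
    have : g =ᵐ[radonProd μ ν] fun _ => (0 : ℝ) := by
      have hU' : ∀ᵐ p ∂(radonProd μ ν), p ∉ U := measure_eq_zero_iff_ae_notMem.mp h0
      filter_upwards [hU'] with p hp
      change a p.1 * b p.2 = 0
      by_cases h1 : p.1 ∈ V
      · rw [b2 p.2 fun h2 => hp (hVW ⟨h1, h2⟩), mul_zero]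
      · rw [a2 p.1 h1, zero_mul]
    rw [integral_congr_ae this, integral_zero] at hg
    exact (mul_pos pa pb).ne hg

theorem integral_radonProd_real [μ.Regular] [ν.Regular] (hμ : IsCompact μ.support)
    (hν : IsCompact ν.support) {f : X × Y → ℝ} (hf : Continuous f) :
    ∫ p, f p ∂(radonProd μ ν) = ∫ x, ∫ y, f (x, y) ∂ν ∂μ := by
  obtain ⟨g, g1, -, -⟩ := exists_cutoff (hμ.prod hν) isOpen_univ (subset_univ _)
  let F : C_c(X × Y, ℝ) := ⟨⟨fun p => f p * g p, by fun_prop⟩, g.hasCompactSupport.mul_left⟩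
  have h1 : ∫ p, f p ∂(radonProd μ ν) = ∫ p, F p ∂(radonProd μ ν) := by
    refine integral_congr_ae ?_
    filter_upwards [ae_mem_support (radonProd μ ν)] with p hp
    rw [support_radonProd μ ν hμ hν] at hp
    change f p = f p * g p
    rw [g1 p hp, mul_one]
  rw [h1, integral_radonProd_cc]
  refine integral_congr_ae ?_
  filter_upwards [ae_mem_support μ] with x hx
  refine integral_congr_ae ?_
  filter_upwards [ae_mem_support ν] with y hy
  change f (x, y) * g (x, y) = f (x, y)
  rw [g1 _ ⟨hx, hy⟩, mul_one]

end RadonProduct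

/-! ### Hypergroups -/

/-- A (locally compact) hypergroup structure in the sense of Jewett on a locally compact Hausdorff
space `K` with its Borel `σ`-algebra: a convolution `(x, y) ↦ ω(x, y) = δ_x * δ_y`, an identity and
an involution. -/
class Hypergroup (K : Type*) [TopologicalSpace K] [MeasurableSpace K] where
  /-- The convolution `ω(x, y)` of the point masses at `x` and `y`. -/
  conv : K → K → Measure K
  /-- The identity element. -/
  e : K
  /-- The involution `x ↦ x̃`. -/
  inv : K → K
  isProbabilityMeasure_conv : ∀ x y, IsProbabilityMeasure (conv x y)
  regular_conv : ∀ x y, (conv x y).Regular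
  isCompact_support_conv : ∀ x y, IsCompact (conv x y).support
  /-- `(x, y) ↦ ω(x, y)` is weakly continuous. -/
  continuous_conv : ∀ f : K →ᵇ ℝ, Continuous fun p : K × K => ∫ t, f t ∂(conv p.1 p.2)
  /-- `(x, y) ↦ supp ω(x, y)` is continuous into the space of compact subsets of `K` with the
  Michael (Vietoris) topology. -/
  continuous_support_conv : Continuous fun p : K × K =>
    (⟨(conv p.1 p.2).support, isCompact_support_conv p.1 p.2⟩ : TopologicalSpace.Compacts K)
  /-- Associativity `(δ_x * δ_y) * δ_z = δ_x * (δ_y * δ_z)`. -/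
  conv_assoc : ∀ (x y z : K) (f : K →ᵇ ℝ),
    ∫ t, ∫ s, f s ∂(conv t z) ∂(conv x y) = ∫ t, ∫ s, f s ∂(conv x t) ∂(conv y z)
  e_conv : ∀ x, conv e x = Measure.dirac x
  conv_e : ∀ x, conv x e = Measure.dirac x
  continuous_inv : Continuous inv
  inv_inv : ∀ x, inv (inv x) = x
  /-- `(δ_x * δ_y)~ = δ_ỹ * δ_x̃`. -/
  map_inv_conv : ∀ x y, (conv x y).map inv = conv (inv y) (inv x)
  e_mem_support_conv_iff : ∀ x y, e ∈ (conv x y).support ↔ x = inv y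

/-- A commutative hypergroup: `ω(x, y) = ω(y, x)`. -/
class CommHypergroup (K : Type*) [TopologicalSpace K] [MeasurableSpace K]
    extends Hypergroup K where
  conv_comm : ∀ x y, conv x y = conv y x

namespace Hypergroup

attribute [instance] isProbabilityMeasure_conv regular_conv

section Basic

variable {K : Type*} [TopologicalSpace K] [T2Space K] [LocallyCompactSpace K]
  [MeasurableSpace K] [BorelSpace K] [Hypergroup K]

theorem integrable_conv {E : Type*} [NormedAddCommGroup E] [SecondCountableTopology E] (x y : K)
    {f : K → E} (hf : Continuous f) : Integrable f (conv x y) := by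
  have h := hf.continuousOn.integrableOn_compact (μ := conv x y) (isCompact_support_conv x y)
  rwa [IntegrableOn, Measure.restrict_eq_self_of_ae_mem (ae_mem_support (conv x y))] at h

theorem eventually_support_subset {P : Type*} [TopologicalSpace P] {a b : P → K}
    (ha : Continuous a) (hb : Continuous b) (p₀ : P) {U : Set K} (hU : IsOpen U)
    (h : (conv (a p₀) (b p₀)).support ⊆ U) :
    ∀ᶠ p in 𝓝 p₀, (conv (a p) (b p)).support ⊆ U :=
  ((continuous_support_conv (K := K)).comp (ha.prodMk hb)).continuousAt.eventually
    ((TopologicalSpace.Compacts.isOpen_subsets_of_isOpen hU).mem_nhds h)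

/-- Continuity of parametric integrals against `ω`. -/
theorem continuous_integral_conv {P : Type*} [TopologicalSpace P] {a b : P → K}
    (ha : Continuous a) (hb : Continuous b) {G : P → K → ℝ} (hG : Continuous G.uncurry) :
    Continuous fun p => ∫ s, G p s ∂(conv (a p) (b p)) := by
  rw [continuous_iff_continuousAt]
  intro p₀
  obtain ⟨C, hC, hCs⟩ := exists_compact_superset (isCompact_support_conv (a p₀) (b p₀))
  obtain ⟨g, g1, -, -⟩ := exists_cutoff hC isOpen_univ (subset_univ _)
  have hG0 : Continuous (G p₀) := hG.comp (Continuous.prodMk_right p₀)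
  let F : C_c(K, ℝ) := ⟨⟨fun s => G p₀ s * g s, by fun_prop⟩, g.hasCompactSupport.mul_left⟩
  have hF : Tendsto (fun p => ∫ s, F s ∂(conv (a p) (b p))) (𝓝 p₀)
      (𝓝 (∫ s, F s ∂(conv (a p₀) (b p₀)))) :=
    ((continuous_conv (K := K) (F : K →ᵇ ℝ)).comp (ha.prodMk hb)).continuousAt
  have hsupp := eventually_support_subset ha hb p₀ isOpen_interior hCs
  have hFG : ∀ p, (conv (a p) (b p)).support ⊆ interior C →
      ∫ s, F s ∂(conv (a p) (b p)) = ∫ s, G p₀ s ∂(conv (a p) (b p)) := by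
    intro p hp
    refine integral_congr_ae ?_
    filter_upwards [ae_mem_support (conv (a p) (b p))] with s hs
    change G p₀ s * g s = G p₀ s
    rw [g1 s (interior_subset (hp hs)), mul_one]
  rw [ContinuousAt, Metric.tendsto_nhds]
  intro ε hε
  have hunif : ∀ᶠ p in 𝓝 p₀, ∀ s ∈ C, dist (G p s) (G p₀ s) < ε / 2 := by
    refine hC.eventually_forall_of_forall_eventually fun s _ => ?_
    have h1 : Continuous fun z : P × K => dist (G z.1 z.2) (G p₀ z.2) :=
      (hG : Continuous fun z : P × K => G z.1 z.2).dist (hG0.comp continuous_snd)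
    refine h1.continuousAt.eventually_lt continuousAt_const ?_
    simpa using half_pos hε
  filter_upwards [hunif, hsupp, (Metric.tendsto_nhds.mp hF) (ε / 2) (half_pos hε)] with p h1 h2 h3
  rw [hFG p h2, hFG p₀ hCs] at h3
  have hGp : Continuous (G p) := hG.comp (Continuous.prodMk_right p)
  have h4 : dist (∫ s, G p s ∂(conv (a p) (b p))) (∫ s, G p₀ s ∂(conv (a p) (b p))) ≤ ε / 2 := by
    rw [dist_eq_norm, ← integral_sub (integrable_conv _ _ hGp) (integrable_conv _ _ hG0)]
    have := norm_integral_le_of_norm_le_const (μ := conv (a p) (b p))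
      (f := fun s => G p s - G p₀ s) (C := ε / 2) (by
        filter_upwards [ae_mem_support (conv (a p) (b p))] with s hs
        rw [← dist_eq_norm]
        exact (h1 s (interior_subset (h2 hs))).le)
    simpa using this
  calc _ ≤ _ := dist_triangle _ _ _
    _ < ε / 2 + ε / 2 := add_lt_add_of_le_of_lt h4 h3
    _ = ε := add_halves ε

theorem measurable_conv (x : K) : Measurable fun y : K => conv x y := by
  refine Measurable.measure_of_isPiSystem_of_isProbabilityMeasure
    (BorelSpace.measurable_eq (α := K)) isPiSystem_isOpen fun U hU => ?_
  refine LowerSemicontinuous.measurable fun y₀ r hr => ?_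
  change r < conv x y₀ U at hr
  rw [IsOpen.measure_eq_iSup_isCompact hU] at hr
  obtain ⟨L, hr⟩ := lt_iSup_iff.mp hr
  obtain ⟨hLU, hr⟩ := lt_iSup_iff.mp hr
  obtain ⟨hL, hr⟩ := lt_iSup_iff.mp hr
  obtain ⟨g, g1, g2, g3⟩ := exists_cutoff hL hU hLU
  have hle : ∀ y, ENNReal.ofReal (∫ s, g s ∂(conv x y)) ≤ conv x y U := fun y =>
    integral_le_measure (fun s _ => (g3 s).2) fun s hs => (g2 s hs).le
  have hge : conv x y₀ L ≤ ENNReal.ofReal (∫ s, g s ∂(conv x y₀)) :=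
    g.integrable.measure_le_integral (.of_forall fun s => (g3 s).1) fun s hs => (g1 s hs).ge
  have hc : Continuous fun y => ENNReal.ofReal (∫ s, g s ∂(conv x y)) :=
    ENNReal.continuous_ofReal.comp
      (continuous_integral_conv continuous_const continuous_id (G := fun _ s => g s)
        (g.continuous.comp continuous_snd))
  filter_upwards [hc.continuousAt.eventually_const_lt (hr.trans_le hge)] with y hy
  exact hy.trans_le (hle y)

end Basic

/-! ### The product of two hypergroups -/

section Product

variable {K H : Type*} [TopologicalSpace K] [T2Space K] [LocallyCompactSpace K]
  [MeasurableSpace K] [BorelSpace K] [TopologicalSpace H] [T2Space H] [LocallyCompactSpace H]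
  [MeasurableSpace H] [BorelSpace H] [MeasurableSpace (K × H)] [BorelSpace (K × H)]

section

variable [Hypergroup K] [Hypergroup H]

theorem integral_prodConv (x y : K) (x' y' : H) {f : K × H → ℝ} (hf : Continuous f) :
    ∫ p, f p ∂(radonProd (conv x y) (conv x' y')) =
      ∫ s, ∫ t, f (s, t) ∂(conv x' y') ∂(conv x y) :=
  integral_radonProd_real _ _ (isCompact_support_conv x y) (isCompact_support_conv x' y') hf

theorem continuous_iterated {P : Type*} [TopologicalSpace P] {a b : P → K} {a' b' : P → H}
    (ha : Continuous a) (hb : Continuous b) (ha' : Continuous a') (hb' : Continuous b')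
    {F : P → K → H → ℝ} (hF : Continuous fun z : (P × K) × H => F z.1.1 z.1.2 z.2) :
    Continuous fun p => ∫ s, ∫ t, F p s t ∂(conv (a' p) (b' p)) ∂(conv (a p) (b p)) :=
  continuous_integral_conv ha hb (G := fun p s => ∫ t, F p s t ∂(conv (a' p) (b' p)))
    (continuous_integral_conv (P := P × K) (ha'.comp continuous_fst) (hb'.comp continuous_fst)
      (G := fun z t => F z.1 z.2 t) hF)

theorem integral_swap_conv (x y : K) (x' y' : H) {f : K → H → ℝ} (hf : Continuous f.uncurry) :
    ∫ s, ∫ t, f s t ∂(conv x' y') ∂(conv x y) = ∫ t, ∫ s, f s t ∂(conv x y) ∂(conv x' y') :=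
  integral_swap_of_support _ _ (isCompact_support_conv x y) (isCompact_support_conv x' y') hf

theorem prodConv_eq_dirac {x y z : K} {x' y' z' : H} (h : conv x y = Measure.dirac z)
    (h' : conv x' y' = Measure.dirac z') :
    radonProd (conv x y) (conv x' y') = Measure.dirac (z, z') := by
  have hs := support_radonProd _ _ (isCompact_support_conv x y) (isCompact_support_conv x' y')
  have := isProbabilityMeasure_radonProd _ _ (isCompact_support_conv x y)
    (isCompact_support_conv x' y')
  have h1 : (conv x y).support ⊆ {z} :=
    Measure.support_subset_of_isClosed isClosed_singleton (by rw [h]; simp)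
  have h2 : (conv x' y').support ⊆ {z'} :=
    Measure.support_subset_of_isClosed isClosed_singleton (by rw [h']; simp)
  have hae : ∀ᵐ p ∂(radonProd (conv x y) (conv x' y')), p ∈ ({(z, z')} : Set (K × H)) := by
    filter_upwards [ae_mem_support (radonProd (conv x y) (conv x' y'))] with p hp
    rw [hs] at hp
    exact Prod.ext (h1 hp.1) (h2 hp.2)
  have hr := Measure.restrict_eq_self_of_ae_mem hae
  rw [Measure.restrict_singleton] at hr
  have hone : radonProd (conv x y) (conv x' y') {(z, z')} = 1 := by
    rw [← measure_univ (μ := radonProd (conv x y) (conv x' y'))]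
    exact measure_congr (eventuallyEq_univ.mpr hae)
  rw [← hr, hone, one_smul]

theorem prodConv_assoc (x y z : K) (x' y' z' : H) (f : K × H →ᵇ ℝ) :
    ∫ t, ∫ t', ∫ s, ∫ s', f (s, s') ∂(conv t' z') ∂(conv t z) ∂(conv x' y') ∂(conv x y) =
      ∫ t, ∫ t', ∫ s, ∫ s', f (s, s') ∂(conv x' t') ∂(conv x t) ∂(conv y' z') ∂(conv y z) := by
  have hf := f.continuous
  have hcont : Continuous fun s => ∫ t', ∫ s', f (s, s') ∂(conv x' t') ∂(conv y' z') :=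
    continuous_integral_conv (P := K) continuous_const continuous_const
      (G := fun s t' => ∫ s', f (s, s') ∂(conv x' t'))
      (continuous_integral_conv (P := K × H) continuous_const continuous_snd
        (G := fun p s' => f (p.1, s')) (by
          change Continuous fun z : (K × H) × H => f (z.1.1, z.2)
          fun_prop))
  have hbound : ∀ s, ‖∫ t', ∫ s', f (s, s') ∂(conv x' t') ∂(conv y' z')‖ ≤ ‖f‖ := by
    intro s
    have h1 : ∀ t', ‖∫ s', f (s, s') ∂(conv x' t')‖ ≤ ‖f‖ := fun t' => by
      simpa using norm_integral_le_of_norm_le_const (μ := conv x' t')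
        (.of_forall fun s' => f.norm_coe_le_norm (s, s'))
    simpa using norm_integral_le_of_norm_le_const (μ := conv y' z') (.of_forall h1)
  have hK := conv_assoc x y z (BoundedContinuousFunction.ofNormedAddCommGroup _ hcont _ hbound)
  simp only [BoundedContinuousFunction.coe_ofNormedAddCommGroup] at hK
  have hH : ∀ s, ∫ t', ∫ s', f (s, s') ∂(conv t' z') ∂(conv x' y') =
      ∫ t', ∫ s', f (s, s') ∂(conv x' t') ∂(conv y' z') := fun s =>
    conv_assoc x' y' z' (f.compContinuous ⟨fun t => (s, t), by fun_prop⟩)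
  calc _ = ∫ t, ∫ s, ∫ t', ∫ s', f (s, s') ∂(conv t' z') ∂(conv x' y') ∂(conv t z)
        ∂(conv x y) := by
        refine integral_congr_ae (.of_forall fun t => ?_)
        refine (integral_swap_conv t z x' y' (f := fun s t' => ∫ s', f (s, s') ∂(conv t' z'))
          ?_).symm
        exact continuous_integral_conv (P := K × H) continuous_snd continuous_const
          (G := fun p s' => f (p.1, s')) (by
            change Continuous fun z : (K × H) × H => f (z.1.1, z.2)
            fun_prop)
    _ = ∫ t, ∫ s, ∫ t', ∫ s', f (s, s') ∂(conv x' t') ∂(conv y' z') ∂(conv t z)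
        ∂(conv x y) := by simp_rw [hH]
    _ = ∫ t, ∫ s, ∫ t', ∫ s', f (s, s') ∂(conv x' t') ∂(conv y' z') ∂(conv x t)
        ∂(conv y z) := hK
    _ = _ := by
        refine integral_congr_ae (.of_forall fun t => ?_)
        refine integral_swap_conv x t y' z' (f := fun s t' => ∫ s', f (s, s') ∂(conv x' t')) ?_
        exact continuous_integral_conv (P := K × H) continuous_const continuous_snd
          (G := fun p s' => f (p.1, s')) (by
            change Continuous fun z : (K × H) × H => f (z.1.1, z.2)
            fun_prop)

/-- The involution of a hypergroup as a homeomorphism. -/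
def invHomeomorph (K : Type*) [TopologicalSpace K] [MeasurableSpace K] [Hypergroup K] : K ≃ₜ K where
  toFun := inv
  invFun := inv
  left_inv := inv_inv
  right_inv := inv_inv
  continuous_toFun := continuous_inv
  continuous_invFun := continuous_inv

theorem integral_comp_inv (x y : K) {f : K → ℝ} (hf : Continuous f) :
    ∫ s, f (inv s) ∂(conv x y) = ∫ s, f s ∂(conv (inv y) (inv x)) := by
  rw [← map_inv_conv, integral_map continuous_inv.measurable.aemeasurable
    hf.aestronglyMeasurable]

theorem map_inv_prodConv (x y : K) (x' y' : H) :
    (radonProd (conv x y) (conv x' y')).map (fun p : K × H => (inv p.1, inv p.2)) =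
      radonProd (conv (inv y) (inv x)) (conv (inv y') (inv x')) := by
  have hφ : Continuous fun p : K × H => (inv p.1, inv p.2) :=
    (continuous_inv.comp continuous_fst).prodMk (continuous_inv.comp continuous_snd)
  have : ((radonProd (conv x y) (conv x' y')).map
      (fun p : K × H => (inv p.1, inv p.2))).Regular :=
    Measure.Regular.map (μ := radonProd (conv x y) (conv x' y'))
      ((invHomeomorph K).prodCongr (invHomeomorph H))
  refine Measure.ext_of_integral_eq_on_compactlySupported fun f => ?_
  have hf : Continuous f := f.continuous
  rw [integral_map hφ.measurable.aemeasurable hf.aestronglyMeasurable,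
    integral_prodConv _ _ _ _ (f := fun p => f (inv p.1, inv p.2)) (hf.comp hφ),
    integral_prodConv _ _ _ _ hf]
  have h1 : ∀ s : K, ∫ t, f (inv s, inv t) ∂(conv x' y') =
      ∫ t, f (inv s, t) ∂(conv (inv y') (inv x')) := fun s =>
    integral_comp_inv x' y' (f := fun t => f (inv s, t)) (by fun_prop)
  simp only [h1]
  refine integral_comp_inv x y (f := fun s => ∫ t, f (s, t) ∂(conv (inv y') (inv x'))) ?_
  exact continuous_integral_conv continuous_const continuous_const
    (G := fun s t => f (s, t)) hf

/-- The product hypergroup `K × H`: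
`ω((x, x'), (y, y')) = ω(x, y) ⊗ ω(x', y')`, with identity `(e, e)` and `(x, x')~ = (x̃, x̃')`. -/
instance instProd : Hypergroup (K × H) where
  conv p q := radonProd (conv p.1 q.1) (conv p.2 q.2)
  e := (e, e)
  inv p := (inv p.1, inv p.2)
  isProbabilityMeasure_conv p q :=
    isProbabilityMeasure_radonProd _ _ (isCompact_support_conv _ _) (isCompact_support_conv _ _)
  regular_conv p q := inferInstance
  isCompact_support_conv p q := by
    rw [support_radonProd _ _ (isCompact_support_conv _ _) (isCompact_support_conv _ _)]
    exact (isCompact_support_conv _ _).prod (isCompact_support_conv _ _)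
  continuous_conv f := by
    simp_rw [integral_prodConv _ _ _ _ f.continuous]
    refine continuous_integral_conv (P := (K × H) × (K × H)) (a := fun p => p.1.1)
      (b := fun p => p.2.1) (by fun_prop) (by fun_prop)
      (G := fun p s => ∫ t, f (s, t) ∂(conv p.1.2 p.2.2)) ?_
    exact continuous_integral_conv (P := ((K × H) × (K × H)) × K) (a := fun p => p.1.1.2)
      (b := fun p => p.1.2.2) (by fun_prop) (by fun_prop)
      (G := fun p t => f (p.2, t)) (by
        change Continuous fun z : (((K × H) × (K × H)) × K) × H => f (z.1.2, z.2)
        fun_prop)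
  continuous_support_conv := by
    have h := TopologicalSpace.Compacts.continuous_prod.comp
      (((continuous_support_conv (K := K)).comp
        (by fun_prop : Continuous fun p : (K × H) × (K × H) => (p.1.1, p.2.1))).prodMk
      ((continuous_support_conv (K := H)).comp
        (by fun_prop : Continuous fun p : (K × H) × (K × H) => (p.1.2, p.2.2))))
    convert h using 2 with p
    exact TopologicalSpace.Compacts.ext
      (support_radonProd _ _ (isCompact_support_conv _ _) (isCompact_support_conv _ _))
  conv_assoc := by
    rintro ⟨x, x'⟩ ⟨y, y'⟩ ⟨z, z'⟩ f
    have hf := f.continuous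
    have hF : ∀ P : Type _, [TopologicalSpace P] → Continuous fun w : (P × K) × H =>
        f (w.1.2, w.2) := fun P _ => by fun_prop
    simp_rw [integral_prodConv _ _ _ _ hf]
    rw [integral_prodConv _ _ _ _ (continuous_iterated continuous_fst continuous_const
      continuous_snd continuous_const (F := fun _ s t => f (s, t)) (hF _)),
      integral_prodConv _ _ _ _ (continuous_iterated continuous_const continuous_fst
      continuous_const continuous_snd (F := fun _ s t => f (s, t)) (hF _))]
    exact prodConv_assoc x y z x' y' z' f
  e_conv p := prodConv_eq_dirac (e_conv p.1) (e_conv p.2)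
  conv_e p := prodConv_eq_dirac (conv_e p.1) (conv_e p.2)
  continuous_inv := (continuous_inv.comp continuous_fst).prodMk (continuous_inv.comp continuous_snd)
  inv_inv p := Prod.ext (inv_inv _) (inv_inv _)
  map_inv_conv p q := map_inv_prodConv p.1 q.1 p.2 q.2
  e_mem_support_conv_iff := by
    rintro ⟨x, x'⟩ ⟨y, y'⟩
    rw [support_radonProd _ _ (isCompact_support_conv _ _) (isCompact_support_conv _ _)]
    simp [e_mem_support_conv_iff, Prod.ext_iff]

end

/-- The product of two commutative hypergroups is a commutative hypergroup. -/
instance instCommProd [CommHypergroup K] [CommHypergroup H] : CommHypergroup (K × H) where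
  toHypergroup := instProd
  conv_comm p q := by
    change radonProd (conv p.1 q.1) (conv p.2 q.2) = radonProd (conv q.1 p.1) (conv q.2 p.2)
    congr 1
    · exact CommHypergroup.conv_comm _ _
    · exact CommHypergroup.conv_comm _ _

end Product

/-! ### Characters, Haar measures and `α`-amenability -/

section Dual

/-- The dual `K̂`: continuous bounded functions `α ≠ 0` with `ω(x, y)(α) = α(x) α(y)` and
`α(x̃) = conj α(x)`, as a subspace of `C(K, ℂ)` with the compact-open topology. -/
abbrev Dual (K : Type*) [TopologicalSpace K] [MeasurableSpace K] [Hypergroup K] : Type _ :=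
  {α : C(K, ℂ) // α ≠ 0 ∧ (∃ C : ℝ, ∀ x, ‖α x‖ ≤ C) ∧
    (∀ x y, ∫ t, α t ∂(conv x y) = α x * α y) ∧ ∀ x, α (inv x) = conj (α x)}

variable {K : Type*} [TopologicalSpace K] [T2Space K] [LocallyCompactSpace K]
  [MeasurableSpace K] [BorelSpace K] [Hypergroup K]

/-- The translation `T_x φ(y) = ∫ φ dω(x, y)`. -/
def translate (x : K) (φ : K → ℂ) (y : K) : ℂ := ∫ t, φ t ∂(conv x y)

/-- A (left) Haar measure: a nonzero Radon measure `m` with `∫ T_x f dm = ∫ f dm` for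
`f ∈ C_c(K)`. Radon measures are normalised to be inner regular on all Borel sets, so that locally
null sets are null and `L^∞(m)` is the space of essentially bounded functions modulo locally null
functions; when `K` is `σ`-compact this is no restriction. -/
structure IsHaarMeasure (m : Measure K) : Prop where
  ne_zero : m ≠ 0
  lt_top_of_isCompact : ∀ ⦃C : Set K⦄, IsCompact C → m C < ∞
  innerRegular : m.InnerRegular
  integral_translate : ∀ (x : K) (f : C_c(K, ℝ)),
    ∫ y, ∫ t, f t ∂(conv x y) ∂m = ∫ y, f y ∂m

theorem memLp_top_of_bounded (m : Measure K) {φ : K → ℂ} (hφ : Measurable φ)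
    {C : ℝ} (hC : ∀ t, ‖φ t‖ ≤ C) : MemLp φ ∞ m :=
  memLp_top_of_bound hφ.aestronglyMeasurable C (.of_forall hC)

theorem measurable_translate (x : K) {φ : K → ℂ} (hφ : Measurable φ) :
    Measurable (translate x φ) :=
  (hφ.stronglyMeasurable.integral_kernel (κ := ⟨fun y => conv x y, measurable_conv x⟩)).measurable

theorem norm_translate_le (x : K) {φ : K → ℂ} {C : ℝ} (hC : ∀ t, ‖φ t‖ ≤ C) (y : K) :
    ‖translate x φ y‖ ≤ C := by
  simpa [translate] using norm_integral_le_of_norm_le_const (μ := conv x y) (.of_forall hC)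

/-- The class in `L^∞(K, m)` of a bounded Borel function. -/
def toLinfty (m : Measure K) (φ : K → ℂ) (hφ : Measurable φ) (hb : ∃ C : ℝ, ∀ t, ‖φ t‖ ≤ C) :
    Lp ℂ ∞ m :=
  (memLp_top_of_bounded m hφ hb.choose_spec).toLp φ

/-- `K` is `α`-amenable (with respect to the Haar measure `m` defining `L^∞(K)`): there is a bounded
linear functional `M` on `L^∞(K)` with `M(α) = 1` and `M(T_x φ) = α(x) M(φ)` for all `x ∈ K` and
`φ ∈ L^∞(K)`; elements of `L^∞(K)` are given by bounded Borel representatives `φ`. -/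
def IsAmenableAt (m : Measure K) (α : Dual K) : Prop :=
  ∃ M : StrongDual ℂ (Lp ℂ ∞ m),
    M (toLinfty m α.1 α.1.continuous.measurable α.2.2.1) = 1 ∧
    ∀ (x : K) (φ : K → ℂ) (hφ : Measurable φ) (hb : ∃ C : ℝ, ∀ t, ‖φ t‖ ≤ C),
      M (toLinfty m (translate x φ) (measurable_translate x hφ)
        (hb.imp fun _ hC => norm_translate_le x hC)) = α.1 x * M (toLinfty m φ hφ hb)

end Dual

section Tensor

variable {K H : Type*} [TopologicalSpace K] [T2Space K] [LocallyCompactSpace K]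
  [MeasurableSpace K] [BorelSpace K] [TopologicalSpace H] [T2Space H] [LocallyCompactSpace H]
  [MeasurableSpace H] [BorelSpace H] [MeasurableSpace (K × H)] [BorelSpace (K × H)]
  [Hypergroup K] [Hypergroup H]

theorem integral_tensor_real (x y : K) (x' y' : H) {u : K → ℝ} {v : H → ℝ} (hu : Continuous u)
    (hv : Continuous v) :
    ∫ p, u p.1 * v p.2 ∂(radonProd (conv x y) (conv x' y')) =
      (∫ s, u s ∂(conv x y)) * ∫ t, v t ∂(conv x' y') := by
  rw [integral_prodConv _ _ _ _ (by fun_prop)]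
  simp only [integral_const_mul, integral_mul_const]

theorem integral_tensor (x y : K) (x' y' : H) {u : K → ℂ} {v : H → ℂ} (hu : Continuous u)
    (hv : Continuous v) :
    ∫ p, u p.1 * v p.2 ∂(conv (x, x') (y, y')) =
      (∫ s, u s ∂(conv x y)) * ∫ t, v t ∂(conv x' y') := by
  have hu1 : Continuous fun s => (u s).re := Complex.continuous_re.comp hu
  have hu2 : Continuous fun s => (u s).im := Complex.continuous_im.comp hu
  have hv1 : Continuous fun s => (v s).re := Complex.continuous_re.comp hv
  have hv2 : Continuous fun s => (v s).im := Complex.continuous_im.comp hv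
  have hI : ∀ {a : K → ℝ} {b : H → ℝ}, Continuous a → Continuous b →
      Integrable (fun p : K × H => a p.1 * b p.2) (conv (x, x') (y, y')) := fun ha hb =>
    integrable_conv _ _ (by fun_prop)
  have hT : ∀ {a : K → ℝ} {b : H → ℝ}, Continuous a → Continuous b →
      ∫ p : K × H, a p.1 * b p.2 ∂(conv (x, x') (y, y')) =
        (∫ s, a s ∂(conv x y)) * ∫ t, b t ∂(conv x' y') := fun ha hb =>
    integral_tensor_real x y x' y' ha hb
  have hiu := integrable_conv x y hu
  have hiv := integrable_conv x' y' hv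
  have hiuv := integrable_conv (x, x') (y, y') (f := fun p : K × H => u p.1 * v p.2) (by fun_prop)
  have e1 := integral_re_add_im hiu
  have e2 := integral_re_add_im hiv
  have e3 := integral_re_add_im hiuv
  simp only [RCLike.re_eq_complex_re, RCLike.im_eq_complex_im, Complex.mul_re, Complex.mul_im,
    RCLike.I_to_complex, Complex.coe_algebraMap] at e1 e2 e3
  rw [integral_sub (hI hu1 hv1) (hI hu2 hv2), integral_add (hI hu1 hv2) (hI hu2 hv1),
    hT hu1 hv1, hT hu2 hv2, hT hu1 hv2, hT hu2 hv1] at e3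
  rw [← e1, ← e2, ← e3]
  apply Complex.ext <;> simp

/-- The character `(α ⊗ β)(x, y) = α(x) β(y)` of `K × H`. -/
def tensor (α : Dual K) (β : Dual H) : Dual (K × H) :=
  ⟨⟨fun p => α.1 p.1 * β.1 p.2, by fun_prop⟩, by
    obtain ⟨α, hα, ⟨A, hA⟩, hα', hα''⟩ := α
    obtain ⟨β, hβ, ⟨B, hB⟩, hβ', hβ''⟩ := β
    refine ⟨?_, ⟨A * B, ?_⟩, ?_, ?_⟩
    · obtain ⟨x, hx⟩ := DFunLike.ne_iff.mp hα
      obtain ⟨y, hy⟩ := DFunLike.ne_iff.mp hβ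
      exact DFunLike.ne_iff.mpr ⟨(x, y), mul_ne_zero hx hy⟩
    · intro p
      change ‖α p.1 * β p.2‖ ≤ A * B
      rw [norm_mul]
      exact mul_le_mul (hA _) (hB _) (norm_nonneg _) ((norm_nonneg _).trans (hA p.1))
    · rintro ⟨x, x'⟩ ⟨y, y'⟩
      change ∫ p : K × H, α p.1 * β p.2 ∂(conv (x, x') (y, y')) = α x * β x' * (α y * β y')
      rw [integral_tensor x y x' y' α.continuous β.continuous, hα', hβ']
      ring
    · rintro ⟨x, x'⟩
      change α (inv x) * β (inv x') = conj (α x * β x')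
      rw [hα'', hβ'', map_mul]⟩

end Tensor

end Hypergroup

end

/-! Restricting a character of `K × H` to `K × {e}` and `{e} × H` inverts `(α, β) ↦ α ⊗ β`,
because `δ_(x, e) * δ_(e, y) = δ_(x, y)`.

For amenability the point is to replace `L^∞` by bounded continuous functions. The smoothing
`φ ↦ (x ↦ ∫ F(x̃ * y) φ(y) dm(y))` with `F ∈ C_c` maps `L^∞` to bounded continuous functions,
commutes with translations and multiplies a character by a constant, which is nonzero when `F`
is concentrated near `e`. So a functional with the required invariance on any subspace of bounded
continuous functions that contains the character and all smoothings yields one on `L^∞`. That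
smoothing commutes with `T_x` rests on the adjoint identity `∫ g T_x f dm = ∫ f T_x̃ g dm`. For
`f, g ∈ C_c` it follows by smoothing with a symmetric approximate unit, and the regularity of the
measures `ω(x, y)` extends it to bounded Borel functions.

If `K × H` is `α ⊗ β`-amenable with functional `N`, then `f ↦ N (f ⊗ β)` and `g ↦ N (α ⊗ g)` show
that `K` and `H` are amenable. Conversely, smoothings on `K × H` have slices `f(x, ·)` that depend
norm continuously on `x`, so for functionals `M` on `K` and `N` on `H` the iterated functional
`f ↦ M (x ↦ N (f(x, ·)))` is defined on them, and interchanging `N` with the integrals against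
`ω(x, s)` gives its invariance. -/

noncomputable section

/-! ### Directed suprema and Radon measures -/

theorem isOpen_setOf_lt_add_of_semicontinuous {X : Type*} [TopologicalSpace X] {g : X → NNReal}
    (hg : UpperSemicontinuous g) {f : X → ℝ≥0∞} (hf : LowerSemicontinuous f) (ε : ℝ≥0∞) :
    IsOpen {x | (g x : ℝ≥0∞) < f x + ε} := by
  have hfε : LowerSemicontinuous fun x => f x + ε := hf.add lowerSemicontinuous_const
  refine isOpen_iff_mem_nhds.mpr fun x hx => ?_
  obtain ⟨q, hgq, hqf⟩ := ENNReal.lt_iff_exists_nnreal_btwn.mp hx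
  filter_upwards [hg x q (ENNReal.coe_lt_coe.mp hgq), hfε x q hqf] with y hy hy'
  exact (ENNReal.coe_lt_coe.mpr hy).trans hy'

section DirectedSuprema

variable {X ι : Type*} [TopologicalSpace X] [MeasurableSpace X] [Nonempty ι] (ν : Measure X)
  [IsFiniteMeasure ν] {S : Set X} {f : ι → X → ℝ≥0∞}

-- By compactness, a single member of the family exceeds `g - δ` on all of `S`.
theorem lintegral_le_iSup_of_upperSemicontinuous_le (hS : IsCompact S) (hν : ∀ᵐ x ∂ν, x ∈ S)
    (hf : ∀ i, LowerSemicontinuous (f i)) (hdir : Directed (· ≤ ·) f) {g : X → NNReal}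
    (hg : UpperSemicontinuous g) (hgf : ∀ x, (g x : ℝ≥0∞) ≤ ⨆ i, f i x) :
    ∫⁻ x, g x ∂ν ≤ ⨆ i, ∫⁻ x, f i x ∂ν := by
  have approx : ∀ δ : ℝ≥0∞, δ ≠ 0 →
      ∫⁻ x, g x ∂ν ≤ (⨆ i, ∫⁻ x, f i x ∂ν) + δ * ν univ := by
    intro δ hδ
    have cover : S ⊆ ⋃ i, {x | (g x : ℝ≥0∞) < f i x + δ} := fun x _ => by
      have h : (g x : ℝ≥0∞) < ⨆ i, f i x + δ := ENNReal.iSup_add (f := fun i => f i x) ▸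
        (ENNReal.lt_add_right ENNReal.coe_ne_top hδ).trans_le (add_le_add_left (hgf x) δ)
      exact mem_iUnion.mpr (lt_iSup_iff.mp h)
    obtain ⟨i, hi⟩ := hS.elim_directed_cover _
      (fun i => isOpen_setOf_lt_add_of_semicontinuous hg (hf i) δ) cover
      (hdir.mono_comp (g := fun h : X → ℝ≥0∞ => {x | (g x : ℝ≥0∞) < h x + δ}) _
        fun _ _ hle x hx => lt_of_lt_of_le hx (add_le_add_left (hle x) δ))
    calc ∫⁻ x, g x ∂ν ≤ ∫⁻ x, (f i x + δ) ∂ν :=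
          lintegral_mono_ae (hν.mono fun x hx => (hi hx).le)
      _ = (∫⁻ x, f i x ∂ν) + δ * ν univ := by
          rw [lintegral_add_right _ measurable_const, lintegral_const]
      _ ≤ _ := add_le_add_left (le_iSup (fun i => ∫⁻ x, f i x ∂ν) i) _
  have lim : Tendsto (fun δ : ℝ≥0∞ => (⨆ i, ∫⁻ x, f i x ∂ν) + δ * ν univ) (𝓝[≠] 0)
      (𝓝 ((⨆ i, ∫⁻ x, f i x ∂ν) + 0 * ν univ)) :=
    (tendsto_const_nhds.add (ENNReal.Tendsto.mul_const tendsto_id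
      (Or.inr (measure_ne_top ν univ)))).mono_left nhdsWithin_le_nhds
  rw [zero_mul, add_zero] at lim
  exact ge_of_tendsto lim (eventually_mem_nhdsWithin.mono approx)

theorem lintegral_iSup_of_directed_lowerSemicontinuous [BorelSpace X] [ν.WeaklyRegular]
    (hS : IsCompact S) (hν : ∀ᵐ x ∂ν, x ∈ S)
    (hf : ∀ i, LowerSemicontinuous (f i)) (hdir : Directed (· ≤ ·) f) :
    ∫⁻ x, ⨆ i, f i x ∂ν = ⨆ i, ∫⁻ x, f i x ∂ν := by
  refine le_antisymm ?_ (iSup_lintegral_le _)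
  rw [lintegral_eq_nnreal]
  refine iSup₂_le fun φ hφ => ENNReal.le_of_forall_pos_le_add fun ε hε _ => ?_
  obtain ⟨c, hc⟩ := φ.finite_range.bddAbove
  have hφ_int : ∫⁻ x, φ x ∂ν ≠ ∞ := (IsFiniteMeasure.lintegral_lt_top_of_bounded_to_ennreal ν
    ⟨c, fun x => ENNReal.coe_le_coe.mpr (hc (mem_range_self x))⟩).ne
  obtain ⟨g, hgφ, hg, hφg⟩ :=
    φ.exists_upperSemicontinuous_le_lintegral_le hφ_int (ENNReal.coe_ne_zero.mpr hε.ne')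
  have hgf : ∀ x, (g x : ℝ≥0∞) ≤ ⨆ i, f i x := fun x =>
    (ENNReal.coe_le_coe.mpr (hgφ x)).trans (hφ x)
  rw [← SimpleFunc.lintegral_eq_lintegral]
  exact hφg.trans
    (add_le_add_left (lintegral_le_iSup_of_upperSemicontinuous_le ν hS hν hf hdir hg hgf) _)

end DirectedSuprema

theorem innerRegularCompactLTTop_withDensity {X : Type*} [TopologicalSpace X] [T2Space X]
    [MeasurableSpace X] [BorelSpace X] (μ : Measure X) [μ.InnerRegularCompactLTTop]
    {f : X → ℝ≥0∞} (hf : ∫⁻ x, f x ∂μ ≠ ∞) {S : Set X} (hS : MeasurableSet S) (hμS : μ S ≠ ∞)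
    (hfS : ∀ x ∉ S, f x = 0) : (μ.withDensity f).InnerRegularCompactLTTop := by
  refine ⟨fun A hA r hr => ?_⟩
  have hAS : μ.withDensity f A = μ.withDensity f (A ∩ S) := by
    rw [withDensity_apply f hA.1, withDensity_apply f (hA.1.inter hS), inter_comm,
      ← setLIntegral_indicator hS,
      indicator_eq_self.mpr fun x hx => by_contra fun h => hx (hfS x h)]
  rw [hAS] at hr
  obtain ⟨δ, hδ, hsmall⟩ := exists_pos_setLIntegral_lt_of_measure_lt hf (tsub_pos_of_lt hr).ne'
  obtain ⟨C, hCA, hC, hμC⟩ := (hA.1.inter hS).exists_isCompact_sdiff_lt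
    (measure_ne_top_of_subset inter_subset_right hμS) hδ.ne'
  refine ⟨C, hCA.trans inter_subset_left, hC, ?_⟩
  have hdiff : μ.withDensity f (A ∩ S) - μ.withDensity f C <
      μ.withDensity f (A ∩ S) - r := by
    refine (le_measure_sdiff.trans_eq ?_).trans_lt (hsmall _ hμC)
    exact withDensity_apply f ((hA.1.inter hS).diff hC.measurableSet)
  exact lt_of_tsub_lt_tsub_left hdiff

section Bumps

variable {X : Type*} [TopologicalSpace X]

/-- The compactly supported functions `0 ≤ g ≤ 1` vanishing outside `U`: a directed family with
supremum `1_U` when `U` is open, through which Radon measures are compared on open sets. -/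
abbrev UnitBump (U : Set X) : Type _ :=
  {g : C_c(X, ℝ) // (∀ x, 0 ≤ g x) ∧ (∀ x, g x ≤ 1) ∧ ∀ x ∉ U, g x = 0}

instance UnitBump.instNonempty (U : Set X) : Nonempty (UnitBump U) := ⟨⟨0, by simp⟩⟩

theorem UnitBump.directed (U : Set X) :
    Directed (· ≤ ·) fun (g : UnitBump U) (x : X) => g.1 x := by
  intro g g'
  refine ⟨⟨g.1 ⊔ g'.1, fun x => (g.2.1 x).trans le_sup_left,
    fun x => sup_le (g.2.2.1 x) (g'.2.2.1 x), fun x hx => ?_⟩,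
    fun x => le_sup_left, fun x => le_sup_right⟩
  change g.1 x ⊔ g'.1 x = 0
  rw [g.2.2.2 x hx, g'.2.2.2 x hx, sup_idem]

theorem UnitBump.iSup_ofReal_integral [T2Space X] [LocallyCompactSpace X] [MeasurableSpace X]
    [BorelSpace X] (ν : Measure X) [ν.Regular] {U : Set X} (hU : IsOpen U) :
    ⨆ g : UnitBump U, ENNReal.ofReal (∫ x, g.1 x ∂ν) = ν U := by
  refine le_antisymm (iSup_le fun g => ?_) ?_
  · exact integral_le_measure (fun x _ => g.2.2.1 x) fun x hx => (g.2.2.2 x hx).le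
  · rw [hU.measure_eq_iSup_isCompact]
    refine iSup₂_le fun C hCU => iSup_le fun hC => ?_
    obtain ⟨g, hg_one, hg_zero, hg⟩ := exists_cutoff hC hU hCU
    refine le_iSup_of_le ⟨g, fun x => (hg x).1, fun x => (hg x).2, hg_zero⟩ ?_
    exact g.integrable.measure_le_integral (.of_forall fun x => (hg x).1) fun x hx =>
      (hg_one x hx).ge

end Bumps

section Fubini

variable {X Y E : Type*} [TopologicalSpace X] [MeasurableSpace X] [BorelSpace X]
  [TopologicalSpace Y] [MeasurableSpace Y] [BorelSpace Y]
  [NormedAddCommGroup E] [NormedSpace ℝ E]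

theorem integrable_prod_smul_of_hasCompactSupport (μ : Measure X) [IsFiniteMeasure μ]
    {ν : Measure Y} [SFinite ν] {F : X → Y → ℝ} (hF : Continuous F.uncurry)
    (hF_supp : HasCompactSupport F.uncurry) {φ : Y → E} (hφ : Integrable φ ν) :
    Integrable (fun p : X × Y => F p.1 p.2 • φ p.2) (μ.prod ν) := by
  obtain ⟨C, hC⟩ := hF.bounded_above_of_compact_support hF_supp
  exact (hφ.comp_snd μ).bdd_smul C
    (hF_supp.stronglyMeasurable_of_prod hF).aestronglyMeasurable (.of_forall hC)

variable [T2Space X] [LocallyCompactSpace X] [T2Space Y] [LocallyCompactSpace Y] [CompleteSpace E]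

theorem integral_integral_smul_swap_of_isCompact_support {μ : Measure X} [IsFiniteMeasure μ]
    [μ.Regular] (hμ : IsCompact μ.support) {ν : Measure Y} [IsFiniteMeasureOnCompacts ν]
    {f : X → Y → ℝ} (hf : Continuous f.uncurry) {D : Set Y} (hD : IsCompact D)
    (hfD : ∀ x ∈ μ.support, ∀ y ∉ D, f x y = 0) {φ : Y → E} (hφ : IntegrableOn φ D ν) :
    ∫ x, ∫ y, f x y • φ y ∂ν ∂μ = ∫ y, (∫ x, f x y ∂μ) • φ y ∂ν := by
  have : IsFiniteMeasure (ν.restrict D) := isFiniteMeasure_restrict.mpr hD.measure_ne_top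
  obtain ⟨g, hg, -, -⟩ := exists_cutoff (hμ.prod hD) isOpen_univ (subset_univ _)
  let F : X → Y → ℝ := fun x y => f x y * g (x, y)
  have hFf : ∀ x ∈ μ.support, ∀ y ∈ D, F x y = f x y := fun x hx y hy => by
    rw [← mul_one (f x y), ← hg _ (mk_mem_prod hx hy)]
  have hF : Continuous F.uncurry := hf.mul (map_continuous g)
  have hF_supp : HasCompactSupport F.uncurry := g.hasCompactSupport.mul_left
  have marginal : ∀ y ∈ D, ∫ x, F x y ∂μ = ∫ x, f x y ∂μ := fun y hy =>
    integral_congr_ae ((ae_mem_support μ).mono fun x hx => hFf x hx y hy)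
  have outside : ∀ y ∉ D, (∫ x, f x y ∂μ) • φ y = 0 := fun y hy => by
    rw [integral_eq_zero_of_ae ((ae_mem_support μ).mono fun x hx => hfD x hx y hy), zero_smul]
  calc ∫ x, ∫ y, f x y • φ y ∂ν ∂μ = ∫ x, ∫ y in D, F x y • φ y ∂ν ∂μ := by
        refine integral_congr_ae ((ae_mem_support μ).mono fun x hx => ?_)
        dsimp only
        rw [← setIntegral_eq_integral_of_forall_compl_eq_zero (s := D) fun y hy => by
          rw [hfD x hx y hy, zero_smul]]
        exact setIntegral_congr_fun hD.measurableSet fun y hy => by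
          simp only [hFf x hx y hy]
    _ = ∫ y in D, ∫ x, F x y • φ y ∂μ ∂ν :=
        integral_integral_swap (integrable_prod_smul_of_hasCompactSupport μ hF hF_supp hφ)
    _ = ∫ y in D, (∫ x, f x y ∂μ) • φ y ∂ν :=
        setIntegral_congr_fun hD.measurableSet fun y hy => by
          simp only [← marginal y hy, integral_smul_const]
    _ = ∫ y, (∫ x, f x y ∂μ) • φ y ∂ν :=
        setIntegral_eq_integral_of_forall_compl_eq_zero outside

end Fubini

/-! ### Supports and translations -/

namespace Hypergroup

section Convolution

variable {K : Type*} [TopologicalSpace K] [MeasurableSpace K] [Hypergroup K]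

theorem e_mem_support_conv_inv (x : K) : e ∈ (conv (inv x) x).support :=
  (e_mem_support_conv_iff _ _).mpr rfl

theorem inv_e : inv (e : K) = e := by
  refine ((e_mem_support_conv_iff e e).mp ?_).symm
  rw [e_conv, Measure.mem_support_iff_forall]
  intro U hU
  rw [Measure.dirac_apply_of_mem (mem_of_mem_nhds hU)]
  exact one_pos

theorem integral_conv_e {E : Type*} [NormedAddCommGroup E] [NormedSpace ℝ E] [CompleteSpace E]
    (x : K) {f : K → E} (hf : StronglyMeasurable f) : ∫ t, f t ∂(conv x e) = f x := by
  rw [conv_e, integral_dirac' f x hf]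

theorem exists_isCompact_support_subset {C D : Set K} (hC : IsCompact C) (hD : IsCompact D) :
    ∃ E : Set K, IsCompact E ∧ ∀ x ∈ C, ∀ y ∈ D, (conv x y).support ⊆ E := by
  have h := TopologicalSpace.Compacts.isCompact_biUnion_coe_of_isCompact
    ((hC.prod hD).image (continuous_support_conv (K := K)))
  refine ⟨_, h, fun x hx y hy t ht => ?_⟩
  simp only [mem_iUnion]
  exact ⟨_, ⟨(x, y), ⟨hx, hy⟩, rfl⟩, ht⟩

theorem inv_mem_support_conv [BorelSpace K] {x y t : K} (ht : t ∈ (conv x y).support) :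
    inv t ∈ (conv (inv y) (inv x)).support := by
  rw [← map_inv_conv, Measure.mem_support_iff_forall]
  intro V hV
  exact ((Measure.mem_support_iff_forall t).mp ht _ (continuous_inv.continuousAt hV)).trans_le
    (Measure.le_map_apply continuous_inv.aemeasurable V)

end Convolution

variable {K : Type*} [TopologicalSpace K] [T2Space K] [LocallyCompactSpace K]
  [MeasurableSpace K] [Hypergroup K]

theorem exists_symmetric_bump {U : Set K} (hU : IsOpen U) (he : e ∈ U) :
    ∃ k : C_c(K, ℝ), (∀ t, 0 ≤ k t) ∧ (∀ t ∉ U, k t = 0) ∧ 0 < k e ∧ ∀ t, k (inv t) = k t := by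
  obtain ⟨f, hf_one, hf_zero, hf⟩ :=
    exists_cutoff isCompact_singleton hU (singleton_subset_iff.mpr he)
  let k : C_c(K, ℝ) := ⟨⟨fun t => f t * f (inv t),
    (map_continuous f).mul ((map_continuous f).comp continuous_inv)⟩, f.hasCompactSupport.mul_right⟩
  have hk : ∀ t, k t = f t * f (inv t) := fun _ => rfl
  refine ⟨k, fun t => mul_nonneg (hf _).1 (hf _).1, fun t ht => ?_, ?_, fun t => ?_⟩
  · rw [hk, hf_zero t ht, zero_mul]
  · rw [hk, inv_e, hf_one e rfl, one_mul]
    exact one_pos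
  · rw [hk, hk, inv_inv, mul_comm]

variable [BorelSpace K]

section Support

theorem ae_notMem_of_disjoint_support {x y : K} {U : Set K}
    (h : Disjoint (conv x y).support U) : ∀ᵐ t ∂(conv x y), t ∉ U := by
  filter_upwards [ae_mem_support (conv x y)] with t ht using disjoint_left.mp h ht

theorem exists_isOpen_disjoint_support {Q : Set (K × K)} (hQ : IsCompact Q) {z : K}
    (h : ∀ p ∈ Q, z ∉ (conv p.1 p.2).support) :
    ∃ U : Set K, IsOpen U ∧ z ∈ U ∧ ∀ p ∈ Q, Disjoint (conv p.1 p.2).support U := by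
  have small : ∀ᶠ W in (𝓝 z).smallSets, ∀ p ∈ Q, Disjoint (conv p.1 p.2).support W := by
    refine hQ.induction_on (p := fun Q => ∀ᶠ W in (𝓝 z).smallSets, ∀ p ∈ Q,
      Disjoint (conv p.1 p.2).support W) (by simp) (fun s t hst ht => ?_) (fun s t hs ht => ?_) ?_
    · exact ht.mono fun W hW p hp => hW p (hst hp)
    · exact (hs.and ht).mono fun W hW p hp => hp.elim (hW.1 p) (hW.2 p)
    · intro p hp
      obtain ⟨V, U, hV, hU, hpV, hzU, hVU⟩ :=
        SeparatedNhds.of_isCompact_isCompact (isCompact_support_conv p.1 p.2)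
          (isCompact_singleton (x := z)) (disjoint_singleton_right.mpr (h p hp))
      refine ⟨_, mem_nhdsWithin_of_mem_nhds
        (eventually_support_subset continuous_fst continuous_snd p hV hpV), ?_⟩
      exact (eventually_smallSets_forall.mpr (hU.mem_nhds (hzU rfl))).mono
        fun W hW q hq => hVU.mono hq fun w hw => hW w hw
  obtain ⟨t, ht, ht_disj⟩ := eventually_smallSets.mp small
  obtain ⟨U, hUt, hU, hzU⟩ := mem_nhds_iff.mp ht
  exact ⟨U, hU, hzU, ht_disj U hUt⟩

theorem integral_conv_pos {x y t : K} (ht : t ∈ (conv x y).support) {f : K → ℝ}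
    (hf : Continuous f) (hf_nonneg : ∀ s, 0 ≤ f s) (hft : 0 < f t) :
    0 < ∫ s, f s ∂(conv x y) := by
  rw [integral_pos_iff_support_of_nonneg hf_nonneg (integrable_conv x y hf)]
  exact (Measure.mem_support_iff_forall t).mp ht _ (hf.isOpen_support.mem_nhds hft.ne')

theorem continuous_integral_conv_pair {f : K → ℝ} (hf : Continuous f) :
    Continuous fun p : K × K => ∫ s, f s ∂(conv p.1 p.2) :=
  continuous_integral_conv continuous_fst continuous_snd (G := fun _ s => f s)
    (hf.comp continuous_snd)

theorem exists_mem_support_conv_of_mem_support_conv {x y z s t : K}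
    (ht : t ∈ (conv y z).support) (hs : s ∈ (conv x t).support) :
    ∃ r ∈ (conv x y).support, s ∈ (conv r z).support := by
  by_contra! hfar
  obtain ⟨U, hU, hsU, hdisj⟩ := exists_isOpen_disjoint_support
    (Q := (conv x y).support ×ˢ {z}) ((isCompact_support_conv x y).prod isCompact_singleton)
    (z := s) (by rintro ⟨r, _⟩ ⟨hr, rfl⟩; exact hfar r hr)
  obtain ⟨f, hf_one, hf_zero, hf⟩ :=
    exists_cutoff isCompact_singleton hU (singleton_subset_iff.mpr hsU)
  have hzero : ∫ r, ∫ v, f v ∂(conv r z) ∂(conv x y) = 0 := by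
    refine integral_eq_zero_of_ae ((ae_mem_support (conv x y)).mono fun r hr => ?_)
    exact integral_eq_zero_of_ae
      ((ae_notMem_of_disjoint_support (hdisj (r, z) ⟨hr, rfl⟩)).mono fun v hv => hf_zero v hv)
  have hpos : 0 < ∫ r, ∫ v, f v ∂(conv x r) ∂(conv y z) :=
    integral_conv_pos ht
      ((continuous_integral_conv_pair (map_continuous f)).comp (Continuous.prodMk_right x))
      (fun r => integral_nonneg fun v => (hf v).1)
      (integral_conv_pos hs (map_continuous f) (fun v => (hf v).1) (by
        rw [hf_one s rfl]; exact one_pos))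
  exact hpos.ne ((conv_assoc x y z (f : K →ᵇ ℝ)).symm.trans hzero).symm

theorem mem_support_inv_conv {x y t : K} (ht : t ∈ (conv x y).support) :
    y ∈ (conv (inv x) t).support := by
  obtain ⟨r, hr, he⟩ :=
    exists_mem_support_conv_of_mem_support_conv ht (e_mem_support_conv_inv t)
  obtain rfl := (e_mem_support_conv_iff r y).mp he
  simpa only [inv_inv] using inv_mem_support_conv hr

theorem exists_isOpen_dist_le_of_not_disjoint_support {M : Type*} [PseudoMetricSpace M]
    {f : K → M} (hf : Continuous f) {E : Set K} (hE : IsCompact E) {ε : ℝ} (hε : 0 < ε) :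
    ∃ U : Set K, IsOpen U ∧ e ∈ U ∧ ∀ x ∈ E, ∀ y, ¬ Disjoint (conv (inv x) y).support U →
      dist (f y) (f x) ≤ ε := by
  obtain ⟨W, hW, heW⟩ := exists_compact_mem_nhds (e : K)
  obtain ⟨D, hD, hED⟩ := exists_isCompact_support_subset hE hW
  let far : Set (K × K) := {p | ε ≤ dist (f p.2) (f (inv p.1))}
  have hfar : IsClosed far := isClosed_le continuous_const
    ((hf.comp continuous_snd).dist (hf.comp (continuous_inv.comp continuous_fst)))
  have he_far : ∀ p ∈ ((inv '' E) ×ˢ D) ∩ far, (e : K) ∉ (conv p.1 p.2).support := by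
    rintro ⟨u, y⟩ ⟨-, hp⟩ he
    obtain rfl := (e_mem_support_conv_iff u y).mp he
    have : ε ≤ dist (f y) (f (inv (inv y))) := hp
    rw [inv_inv, dist_self] at this
    exact this.not_gt hε
  obtain ⟨U, hU, heU, hdisj⟩ := exists_isOpen_disjoint_support
    (((hE.image continuous_inv).prod hD).inter_right hfar) he_far
  refine ⟨U ∩ interior W, hU.inter isOpen_interior, ⟨heU, mem_interior_iff_mem_nhds.mpr heW⟩,
    fun x hx y hy => ?_⟩
  obtain ⟨t, ht, htU, htW⟩ := not_disjoint_iff.mp hy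
  by_contra! hlt
  have hyD : y ∈ D := by
    have := mem_support_inv_conv ht
    rw [inv_inv] at this
    exact hED x hx t (interior_subset htW) this
  have hp : (inv x, y) ∈ far := by
    change ε ≤ dist (f y) (f (inv (inv x)))
    rw [inv_inv]
    exact hlt.le
  exact disjoint_left.mp (hdisj (inv x, y) ⟨⟨mem_image_of_mem inv hx, hyD⟩, hp⟩) ht htU

end Support

section Translation

theorem exists_isCompact_integral_conv_eq_zero {C S : Set K} (hC : IsCompact C)
    (hS : IsCompact S) : ∃ D : Set K, IsCompact D ∧ ∀ f : K → ℝ, (∀ t ∉ S, f t = 0) →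
      ∀ x ∈ C, ∀ y ∉ D, ∫ t, f t ∂(conv x y) = 0 := by
  obtain ⟨D, hD, hCD⟩ := exists_isCompact_support_subset (hC.image continuous_inv) hS
  refine ⟨D, hD, fun f hf x hx y hy => integral_eq_zero_of_ae ?_⟩
  filter_upwards [ae_mem_support (conv x y)] with t ht
  refine hf t fun htS => hy ?_
  exact hCD _ (mem_image_of_mem inv hx) t htS (mem_support_inv_conv ht)

/-- The translation `T_x f(y) = ∫ f dω(x, y)` as an operator on `C_c(K)`. -/
def ccTranslate (x : K) (f : C_c(K, ℝ)) : C_c(K, ℝ) :=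
  ⟨⟨fun y => ∫ t, f t ∂(conv x y),
    (continuous_integral_conv_pair (map_continuous f)).comp (Continuous.prodMk_right x)⟩, by
    obtain ⟨D, hD, h⟩ := exists_isCompact_integral_conv_eq_zero (isCompact_singleton (x := x))
      f.hasCompactSupport.isCompact
    exact HasCompactSupport.intro hD fun y hy =>
      h f (fun t ht => image_eq_zero_of_notMem_tsupport ht) x rfl y hy⟩

theorem ccTranslate_apply (x : K) (f : C_c(K, ℝ)) (y : K) :
    ccTranslate x f y = ∫ t, f t ∂(conv x y) := rfl

theorem continuous_ccTranslate (f : C_c(K, ℝ)) :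
    Continuous fun p : K × K => ccTranslate p.1 f p.2 :=
  continuous_integral_conv_pair (map_continuous f)

theorem exists_isCompact_ccTranslate_eq_zero {C : Set K} (hC : IsCompact C) (f : C_c(K, ℝ)) :
    ∃ D : Set K, IsCompact D ∧ ∀ x ∈ C, ∀ y ∉ D, ccTranslate x f y = 0 := by
  obtain ⟨D, hD, h⟩ := exists_isCompact_integral_conv_eq_zero hC f.hasCompactSupport.isCompact
  exact ⟨D, hD, h f fun t ht => image_eq_zero_of_notMem_tsupport ht⟩

theorem ccTranslate_nonneg {f : C_c(K, ℝ)} (hf : ∀ t, 0 ≤ f t) (x y : K) :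
    0 ≤ ccTranslate x f y :=
  integral_nonneg hf

theorem ccTranslate_eq_zero_of_disjoint_support {f : C_c(K, ℝ)} {U : Set K}
    (hf : ∀ t ∉ U, f t = 0) {x y : K} (h : Disjoint (conv x y).support U) :
    ccTranslate x f y = 0 :=
  integral_eq_zero_of_ae ((ae_notMem_of_disjoint_support h).mono hf)

theorem ccTranslate_ccTranslate (x y z : K) (f : C_c(K, ℝ)) :
    ccTranslate x (ccTranslate y f) z = ∫ t, ccTranslate t f z ∂(conv y x) :=
  (conv_assoc y x z (f : K →ᵇ ℝ)).symm

theorem ccTranslate_inv_comm {k : C_c(K, ℝ)} (hk : ∀ t, k (inv t) = k t) (x y : K) :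
    ccTranslate (inv x) k y = ccTranslate (inv y) k x := by
  have h := integral_comp_inv (inv x) y (map_continuous k)
  simp only [hk, inv_inv] at h
  exact h

theorem integral_ccTranslate_inv (x y z : K) (f : C_c(K, ℝ)) :
    ∫ t, ccTranslate (inv t) f z ∂(conv x y) =
      ccTranslate (inv x) (ccTranslate (inv y) f) z := by
  rw [ccTranslate_ccTranslate]
  exact integral_comp_inv x y
    ((continuous_ccTranslate f).comp (Continuous.prodMk_left z))

theorem ccTranslate_ccTranslate_inv_comm {k : C_c(K, ℝ)} (hk : ∀ t, k (inv t) = k t)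
    (x y z : K) : ccTranslate x (ccTranslate (inv z) k) y =
      ccTranslate (inv x) (ccTranslate (inv y) k) z := by
  rw [← integral_ccTranslate_inv, ccTranslate_apply]
  simp_rw [ccTranslate_inv_comm hk z]

end Translation

end Hypergroup

/-! ### Smoothing and the adjoint of a translation -/

namespace Hypergroup

theorem IsHaarMeasure.isFiniteMeasureOnCompacts {K : Type*} [TopologicalSpace K]
    [MeasurableSpace K] [Hypergroup K] {m : Measure K} (hm : IsHaarMeasure m) :
    IsFiniteMeasureOnCompacts m :=
  ⟨fun _ hC => hm.lt_top_of_isCompact hC⟩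

variable {K E : Type*} [TopologicalSpace K] [T2Space K] [LocallyCompactSpace K]
  [MeasurableSpace K] [BorelSpace K] [Hypergroup K] [NormedAddCommGroup E] [NormedSpace ℝ E]
  {m : Measure K}

theorem IsHaarMeasure.integral_ccTranslate (hm : IsHaarMeasure m) (x : K) (f : C_c(K, ℝ)) :
    ∫ y, ccTranslate x f y ∂m = ∫ y, f y ∂m :=
  hm.integral_translate x f

theorem IsHaarMeasure.integral_pos (hm : IsHaarMeasure m) {k : C_c(K, ℝ)}
    (hk : ∀ t, 0 ≤ k t) (hke : 0 < k e) : 0 < ∫ y, k y ∂m := by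
  have := hm.isFiniteMeasureOnCompacts
  have := hm.innerRegular
  refine lt_of_le_of_ne (integral_nonneg hk) fun h_zero => hm.ne_zero ?_
  have locally_null : ∀ z : K, ∃ t ∈ 𝓝 z, m t = 0 := by
    intro z
    have hz : 0 < ccTranslate (inv z) k z :=
      integral_conv_pos (e_mem_support_conv_inv z) (map_continuous k) hk hke
    refine ⟨_, (ccTranslate (inv z) k).continuous.isOpen_support.mem_nhds hz.ne', ?_⟩
    by_contra hne
    have hpos := (integral_pos_iff_support_of_nonneg (ccTranslate_nonneg hk (inv z))
      (ccTranslate (inv z) k).integrable).mpr (pos_iff_ne_zero.mpr hne)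
    rw [hm.integral_ccTranslate, ← h_zero] at hpos
    exact hpos.false
  rw [← Measure.measure_univ_eq_zero, MeasurableSet.univ.measure_eq_iSup_isCompact]
  refine le_antisymm (iSup₂_le fun C _ => iSup_le fun hC => ?_) bot_le
  refine (hC.measure_zero_of_nhdsWithin fun z _ => ?_).le
  obtain ⟨t, ht, ht_null⟩ := locally_null z
  exact ⟨t, mem_nhdsWithin_of_mem_nhds ht, ht_null⟩

theorem IsHaarMeasure.exists_symmetric_bump_integral_eq_one (hm : IsHaarMeasure m) {U : Set K}
    (hU : IsOpen U) (he : e ∈ U) :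
    ∃ k : C_c(K, ℝ), (∀ t, 0 ≤ k t) ∧ (∀ t ∉ U, k t = 0) ∧ ∫ t, k t ∂m = 1 ∧
      ∀ t, k (inv t) = k t := by
  obtain ⟨k, hk_nonneg, hkU, hke, hk_symm⟩ := exists_symmetric_bump hU he
  have hpos := hm.integral_pos hk_nonneg hke
  refine ⟨(∫ t, k t ∂m)⁻¹ • k, fun t => ?_, fun t ht => ?_, ?_, fun t => ?_⟩
  · exact mul_nonneg (inv_nonneg.mpr hpos.le) (hk_nonneg t)
  · rw [CompactlySupportedContinuousMap.smul_apply, hkU t ht, smul_zero]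
  · simp only [CompactlySupportedContinuousMap.smul_apply, smul_eq_mul, integral_const_mul]
    exact inv_mul_cancel₀ hpos.ne'
  · simp only [CompactlySupportedContinuousMap.smul_apply, hk_symm]

/-- The smoothing `x ↦ ∫ F(x̃ * y) φ(y) dm(y)` of `φ` by a kernel `F ∈ C_c(K)`, where
`F(x̃ * y)` stands for `∫ F dω(x̃, y)`. It turns elements of `L^∞(K)` into continuous functions
and intertwines translations. -/
def smooth (m : Measure K) (F : C_c(K, ℝ)) (φ : K → E) (x : K) : E :=
  ∫ y, ccTranslate (inv x) F y • φ y ∂m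

theorem continuous_smooth (F : C_c(K, ℝ)) {φ : K → E}
    (hφ : LocallyIntegrable φ m) : Continuous (smooth m F φ) := by
  refine continuous_iff_continuousAt.mpr fun x => ?_
  obtain ⟨C, hC, hxC⟩ := exists_compact_mem_nhds x
  obtain ⟨D, hD, hFD⟩ := exists_isCompact_ccTranslate_eq_zero (hC.image continuous_inv) F
  refine ContinuousOn.continuousAt (s := C) ?_ hxC
  exact continuousOn_integral_bilinear_of_locally_integrable_of_compact_support
    (ContinuousLinearMap.lsmul ℝ ℝ).flip (f := fun x y => ccTranslate (inv x) F y) hD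
    ((continuous_ccTranslate F).comp (continuous_inv.prodMap continuous_id)).continuousOn
    (fun x y hx hy => hFD _ (mem_image_of_mem inv hx) y hy) (hφ.integrableOn_isCompact hD)

theorem integral_smooth_conv [IsFiniteMeasureOnCompacts m] [CompleteSpace E] (F : C_c(K, ℝ))
    {φ : K → E} (hφ : LocallyIntegrable φ m) (x y : K) :
    ∫ t, smooth m F φ t ∂(conv x y) =
      ∫ z, ccTranslate (inv x) (ccTranslate (inv y) F) z • φ z ∂m := by
  obtain ⟨D, hD, hFD⟩ := exists_isCompact_ccTranslate_eq_zero
    ((isCompact_support_conv x y).image continuous_inv) F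
  simp_rw [← integral_ccTranslate_inv]
  exact integral_integral_smul_swap_of_isCompact_support (isCompact_support_conv x y)
    (f := fun t z => ccTranslate (inv t) F z)
    ((continuous_ccTranslate F).comp (continuous_inv.prodMap continuous_id)) hD
    (fun t ht z hz => hFD _ (mem_image_of_mem inv ht) z hz) (hφ.integrableOn_isCompact hD)

theorem IsHaarMeasure.exists_isOpen_norm_smooth_sub_le [CompleteSpace E] (hm : IsHaarMeasure m)
    {φ : K → E} (hφ : Continuous φ) {C : Set K} (hC : IsCompact C) {ε : ℝ} (hε : 0 < ε) :
    ∃ U : Set K, IsOpen U ∧ e ∈ U ∧ ∀ k : C_c(K, ℝ), (∀ t, 0 ≤ k t) → (∀ t ∉ U, k t = 0) →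
      ∫ t, k t ∂m = 1 → ∀ x ∈ C, ‖smooth m k φ x - φ x‖ ≤ ε := by
  have := hm.isFiniteMeasureOnCompacts
  obtain ⟨U, hU, heU, h⟩ := exists_isOpen_dist_le_of_not_disjoint_support hφ hC hε
  refine ⟨U, hU, heU, fun k hk_nonneg hkU hk_one x hx => ?_⟩
  set T := ccTranslate (inv x) k
  have hT_one : ∫ y, T y ∂m = 1 := (hm.integral_ccTranslate _ _).trans hk_one
  have hTφ : Integrable (fun y => T y • φ y) m :=
    (T.continuous.smul hφ).integrable_of_hasCompactSupport T.hasCompactSupport.smul_right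
  have h_sub : smooth m k φ x - φ x = ∫ y, T y • (φ y - φ x) ∂m := by
    simp only [smul_sub]
    rw [integral_sub hTφ (T.integrable.smul_const _), integral_smul_const, hT_one, one_smul]
    rfl
  have h_le : ∀ y, ‖T y • (φ y - φ x)‖ ≤ T y * ε := by
    intro y
    have hT_nonneg : 0 ≤ T y := ccTranslate_nonneg hk_nonneg _ _
    rw [norm_smul, Real.norm_of_nonneg hT_nonneg]
    by_cases hy : Disjoint (conv (inv x) y).support U
    · simp only [T, ccTranslate_eq_zero_of_disjoint_support hkU hy, zero_mul, le_refl]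
    · exact mul_le_mul_of_nonneg_left (dist_eq_norm (φ y) _ ▸ h x hx y hy) hT_nonneg
  calc ‖smooth m k φ x - φ x‖ ≤ ∫ y, T y * ε ∂m :=
        h_sub ▸ norm_integral_le_of_norm_le (T.integrable.mul_const ε) (.of_forall h_le)
    _ = ε := by rw [integral_mul_const, hT_one, one_mul]

section Adjoint

theorem IsHaarMeasure.exists_isOpen_abs_integral_mul_smooth_conv_sub_le (hm : IsHaarMeasure m)
    (x : K) (f g : C_c(K, ℝ)) {ε : ℝ} (hε : 0 < ε) :
    ∃ U : Set K, IsOpen U ∧ e ∈ U ∧ ∀ k : C_c(K, ℝ), (∀ t, 0 ≤ k t) → (∀ t ∉ U, k t = 0) →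
      ∫ t, k t ∂m = 1 →
      |∫ y, g y * ∫ t, smooth m k f t ∂(conv x y) ∂m - ∫ y, g y * ccTranslate x f y ∂m| ≤ ε := by
  have := hm.isFiniteMeasureOnCompacts
  obtain ⟨C, hC, hsupp⟩ := exists_isCompact_support_subset (isCompact_singleton (x := x))
    g.hasCompactSupport.isCompact
  obtain ⟨δ, hδ, hδε⟩ := exists_pos_mul_lt hε (∫ y, |g y| ∂m)
  obtain ⟨U, hU, heU, h⟩ := hm.exists_isOpen_norm_smooth_sub_le (map_continuous f) hC hδ
  refine ⟨U, hU, heU, fun k hk_nonneg hkU hk_one => ?_⟩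
  have hs : Continuous (smooth m k f) := continuous_smooth k f.integrable.locallyIntegrable
  have hTs : Continuous fun y => ∫ t, smooth m k f t ∂(conv x y) :=
    (continuous_integral_conv_pair hs).comp (Continuous.prodMk_right x)
  have h_le : ∀ y, ‖g y * ∫ t, smooth m k f t ∂(conv x y) - g y * ccTranslate x f y‖ ≤
      |g y| * δ := by
    intro y
    rw [← mul_sub, norm_mul, Real.norm_eq_abs]
    by_cases hy : y ∈ tsupport g
    · rw [ccTranslate_apply, ← integral_sub (integrable_conv x y hs)
        (integrable_conv x y (map_continuous f))]
      refine mul_le_mul_of_nonneg_left ?_ (abs_nonneg _)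
      refine (norm_integral_le_of_norm_le_const (C := δ) ?_).trans_eq
        (by rw [probReal_univ, mul_one])
      filter_upwards [ae_mem_support (conv x y)] with t ht
      exact h k hk_nonneg hkU hk_one t (hsupp x rfl y hy ht)
    · simp only [image_eq_zero_of_notMem_tsupport hy, abs_zero, zero_mul, le_refl]
  have hgTs : Integrable (fun y => g y * ∫ t, smooth m k f t ∂(conv x y)) m :=
    ((map_continuous g).mul hTs).integrable_of_hasCompactSupport g.hasCompactSupport.mul_right
  have hgT : Integrable (fun y => g y * ccTranslate x f y) m := (g * ccTranslate x f).integrable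
  rw [← integral_sub hgTs hgT]
  refine (norm_integral_le_of_norm_le (g.integrable.abs.mul_const δ) (.of_forall h_le)).trans ?_
  rw [integral_mul_const]
  exact hδε.le

theorem integral_mul_smooth_conv_comm [IsFiniteMeasureOnCompacts m] {k : C_c(K, ℝ)}
    (hk : ∀ t, k (inv t) = k t) (x : K) (f g : C_c(K, ℝ)) :
    ∫ y, g y * ∫ t, smooth m k f t ∂(conv x y) ∂m =
      ∫ z, f z * ∫ t, smooth m k g t ∂(conv (inv x) z) ∂m := by
  let κ : K → K → ℝ := fun y z => ccTranslate (inv x) (ccTranslate (inv y) k) z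
  have hκ : Continuous κ.uncurry :=
    continuous_integral_conv (P := K × K) continuous_const continuous_snd
      (G := fun p t => ccTranslate (inv p.1) k t) ((continuous_ccTranslate k).comp
        ((continuous_inv.comp (continuous_fst.comp continuous_fst)).prodMk continuous_snd))
  have hsupp : HasCompactSupport fun p : K × K => g p.1 * (κ p.1 p.2 * f p.2) := by
    refine HasCompactSupport.intro
      (g.hasCompactSupport.isCompact.prod f.hasCompactSupport.isCompact) fun p hp => ?_
    by_cases hy : p.1 ∈ tsupport g
    · rw [image_eq_zero_of_notMem_tsupport fun hz => hp ⟨hy, hz⟩, mul_zero, mul_zero]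
    · rw [image_eq_zero_of_notMem_tsupport hy, zero_mul]
  calc ∫ y, g y * ∫ t, smooth m k f t ∂(conv x y) ∂m
      = ∫ y, ∫ z, g y * (κ y z * f z) ∂m ∂m := by
        simp_rw [integral_smooth_conv k f.integrable.locallyIntegrable, smul_eq_mul,
          integral_const_mul]
        rfl
    _ = ∫ z, ∫ y, g y * (κ y z * f z) ∂m ∂m :=
        integral_integral_swap_of_hasCompactSupport
          (((map_continuous g).comp continuous_fst).mul
            (hκ.mul ((map_continuous f).comp continuous_snd))) hsupp
    _ = ∫ z, f z * ∫ t, smooth m k g t ∂(conv (inv x) z) ∂m := by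
        simp_rw [integral_smooth_conv k g.integrable.locallyIntegrable, smul_eq_mul,
          ← integral_const_mul, inv_inv]
        refine integral_congr_ae (.of_forall fun z => integral_congr_ae (.of_forall fun y => ?_))
        simp only [κ, ← ccTranslate_ccTranslate_inv_comm hk x y z]
        ring

-- Smoothing by a symmetric approximate unit makes the identity exact.
theorem IsHaarMeasure.integral_mul_ccTranslate (hm : IsHaarMeasure m) (x : K) (f g : C_c(K, ℝ)) :
    ∫ y, g y * ccTranslate x f y ∂m = ∫ y, f y * ccTranslate (inv x) g y ∂m := by
  have := hm.isFiniteMeasureOnCompacts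
  refine eq_of_forall_dist_le fun ε hε => ?_
  obtain ⟨U, hU, heU, hf⟩ :=
    hm.exists_isOpen_abs_integral_mul_smooth_conv_sub_le x f g (half_pos hε)
  obtain ⟨V, hV, heV, hg⟩ :=
    hm.exists_isOpen_abs_integral_mul_smooth_conv_sub_le (inv x) g f (half_pos hε)
  obtain ⟨k, hk_nonneg, hkUV, hk_one, hk_symm⟩ :=
    hm.exists_symmetric_bump_integral_eq_one (hU.inter hV) ⟨heU, heV⟩
  replace hf := hf k hk_nonneg (fun t ht => hkUV t fun h => ht h.1) hk_one
  replace hg := hg k hk_nonneg (fun t ht => hkUV t fun h => ht h.2) hk_one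
  rw [integral_mul_smooth_conv_comm hk_symm, ← Real.dist_eq, dist_comm] at hf
  exact (dist_triangle _ _ _).trans ((add_le_add hf hg).trans_eq (add_halves ε))

end Adjoint

end Hypergroup

theorem integral_withDensity_ofReal {X E : Type*} [MeasurableSpace X] [NormedAddCommGroup E]
    [NormedSpace ℝ E] {μ : Measure X} {h : X → ℝ} (hh : Measurable h) (hh_nonneg : ∀ x, 0 ≤ h x)
    (φ : X → E) :
    ∫ x, φ x ∂(μ.withDensity fun x => ENNReal.ofReal (h x)) = ∫ x, h x • φ x ∂μ := by
  rw [integral_withDensity_eq_integral_toReal_smul hh.ennreal_ofReal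
    (.of_forall fun _ => ENNReal.ofReal_lt_top)]
  simp only [ENNReal.toReal_ofReal (hh_nonneg _)]

theorem regular_withDensity_ofReal {X : Type*} [TopologicalSpace X] [T2Space X]
    [MeasurableSpace X] [BorelSpace X] (μ : Measure X) [μ.InnerRegularCompactLTTop]
    [IsFiniteMeasureOnCompacts μ] (h : C_c(X, ℝ)) :
    (μ.withDensity fun x => ENNReal.ofReal (h x)).Regular := by
  have hS := h.hasCompactSupport.isCompact
  have := isFiniteMeasure_withDensity_ofReal (h.integrable (μ := μ)).2
  have := innerRegularCompactLTTop_withDensity μ (f := fun x => ENNReal.ofReal (h x))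
    h.integrable.lintegral_lt_top.ne hS.measurableSet hS.measure_ne_top fun x hx => by
      rw [image_eq_zero_of_notMem_tsupport hx, ENNReal.ofReal_zero]
  infer_instance

namespace Hypergroup

variable {K : Type*} [TopologicalSpace K] [T2Space K] [LocallyCompactSpace K]
  [MeasurableSpace K] [BorelSpace K] [Hypergroup K] {m : Measure K}

theorem bind_conv_apply_of_isOpen {ν : Measure K} [IsFiniteMeasure ν] [ν.Regular] {S : Set K}
    (hS : IsCompact S) (hν : ∀ᵐ y ∂ν, y ∈ S) (x : K) {U : Set K} (hU : IsOpen U) :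
    ν.bind (conv x) U = ⨆ g : UnitBump U, ENNReal.ofReal (∫ y, ccTranslate x g.1 y ∂ν) := by
  have hdir : Directed (· ≤ ·)
      fun (g : UnitBump U) (y : K) => ENNReal.ofReal (ccTranslate x g.1 y) := by
    intro g g'
    obtain ⟨k, hgk, hg'k⟩ := UnitBump.directed U g g'
    exact ⟨k, fun y => ENNReal.ofReal_le_ofReal (integral_mono g.1.integrable k.1.integrable hgk),
      fun y => ENNReal.ofReal_le_ofReal (integral_mono g'.1.integrable k.1.integrable hg'k)⟩
  calc ν.bind (conv x) U = ∫⁻ y, conv x y U ∂ν :=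
        Measure.bind_apply hU.measurableSet (measurable_conv x).aemeasurable
    _ = ∫⁻ y, ⨆ g : UnitBump U, ENNReal.ofReal (ccTranslate x g.1 y) ∂ν :=
        lintegral_congr fun y => (UnitBump.iSup_ofReal_integral (conv x y) hU).symm
    _ = ⨆ g : UnitBump U, ∫⁻ y, ENNReal.ofReal (ccTranslate x g.1 y) ∂ν :=
        lintegral_iSup_of_directed_lowerSemicontinuous ν hS hν (fun g =>
          (ENNReal.continuous_ofReal.comp (ccTranslate x g.1).continuous).lowerSemicontinuous) hdir
    _ = ⨆ g : UnitBump U, ENNReal.ofReal (∫ y, ccTranslate x g.1 y ∂ν) :=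
        iSup_congr fun g => (ofReal_integral_eq_lintegral_ofReal (ccTranslate x g.1).integrable
          (.of_forall (ccTranslate_nonneg g.2.1 x))).symm

theorem IsHaarMeasure.bind_conv_withDensity (hm : IsHaarMeasure m) (x : K) {h : C_c(K, ℝ)}
    (hh : ∀ y, 0 ≤ h y) :
    (m.withDensity fun y => ENNReal.ofReal (h y)).bind (conv x) =
      m.withDensity fun y => ENNReal.ofReal (ccTranslate (inv x) h y) := by
  have := hm.isFiniteMeasureOnCompacts
  have := hm.innerRegular
  let mul : C_c(K, ℝ) → Measure K := fun f => m.withDensity fun y => ENNReal.ofReal (f y)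
  have hfin : ∀ f, IsFiniteMeasure (mul f) := fun f =>
    isFiniteMeasure_withDensity_ofReal f.integrable.2
  have hreg : ∀ f, (mul f).Regular := regular_withDensity_ofReal m
  have hcarrier : ∀ᵐ y ∂(mul h), y ∈ tsupport h := by
    rw [ae_withDensity_iff (map_continuous h).measurable.ennreal_ofReal]
    refine .of_forall fun y => not_imp_comm.mp fun hy => ?_
    rw [image_eq_zero_of_notMem_tsupport hy, ENNReal.ofReal_zero]
  have hbind : IsFiniteMeasure ((mul h).bind (conv x)) := by
    refine ⟨?_⟩
    rw [Measure.bind_apply .univ (measurable_conv x).aemeasurable]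
    simp
  have hopen : ∀ U, IsOpen U → (mul h).bind (conv x) U = mul (ccTranslate (inv x) h) U := by
    intro U hU
    rw [bind_conv_apply_of_isOpen h.hasCompactSupport.isCompact hcarrier x hU,
      ← UnitBump.iSup_ofReal_integral _ hU]
    refine iSup_congr fun g => congrArg ENNReal.ofReal ?_
    rw [integral_withDensity_ofReal (map_continuous h).measurable hh,
      integral_withDensity_ofReal (map_continuous _).measurable (ccTranslate_nonneg hh _)]
    simp only [smul_eq_mul]
    rw [hm.integral_mul_ccTranslate]
    simp only [mul_comm]
  exact ext_of_generate_finite {U : Set K | IsOpen U} (BorelSpace.measurable_eq (α := K))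
    isPiSystem_isOpen hopen (hopen univ isOpen_univ)

theorem IsHaarMeasure.integral_smul_translate (hm : IsHaarMeasure m) (x : K) {h : C_c(K, ℝ)}
    (hh : ∀ y, 0 ≤ h y) {φ : K → ℂ} (hφ : Measurable φ) {C : ℝ} (hC : ∀ t, ‖φ t‖ ≤ C) :
    ∫ y, h y • translate x φ y ∂m = ∫ y, ccTranslate (inv x) h y • φ y ∂m := by
  have := hm.isFiniteMeasureOnCompacts
  let ν := m.withDensity fun y => ENNReal.ofReal (h y)
  have : IsFiniteMeasure ν := isFiniteMeasure_withDensity_ofReal h.integrable.2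
  let κ : ProbabilityTheory.Kernel K K := ⟨conv x, measurable_conv x⟩
  have : ProbabilityTheory.IsMarkovKernel κ := ⟨fun y => isProbabilityMeasure_conv x y⟩
  calc ∫ y, h y • translate x φ y ∂m
      = ∫ y, translate x φ y ∂ν :=
        (integral_withDensity_ofReal (map_continuous h).measurable hh _).symm
    _ = ∫ t, φ t ∂(ν.bind (conv x)) :=
        (ProbabilityTheory.Kernel.integral_comp (η := κ)
          (κ := ProbabilityTheory.Kernel.const Unit ν) (a := ()) (f := φ)
          (Integrable.of_bound hφ.aestronglyMeasurable C (.of_forall hC))).symm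
    _ = ∫ y, ccTranslate (inv x) h y • φ y ∂m := by
        rw [hm.bind_conv_withDensity x hh, integral_withDensity_ofReal
          (map_continuous _).measurable (ccTranslate_nonneg hh _)]

end Hypergroup

/-! ### Amenability through bounded continuous functions -/

theorem ae_norm_le_norm_Lp {X : Type*} [MeasurableSpace X] {μ : Measure X} (φ : Lp ℂ ∞ μ) :
    ∀ᵐ x ∂μ, ‖φ x‖ ≤ ‖φ‖ := by
  filter_upwards [ae_le_eLpNormEssSup (f := φ) (μ := μ)] with x hx
  rw [← eLpNorm_exponent_top] at hx
  exact (toReal_enorm (φ x)).symm.trans_le (ENNReal.toReal_mono (Lp.eLpNorm_ne_top φ) hx)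

namespace Hypergroup

section Linfty

variable {K : Type*} [TopologicalSpace K] [MeasurableSpace K] [BorelSpace K] {m : Measure K}

theorem integrable_smul_Lp [IsFiniteMeasureOnCompacts m] (h : C_c(K, ℝ)) (φ : Lp ℂ ∞ m) :
    Integrable (fun y => h y • φ y) m :=
  h.integrable.smul_of_top_left (Lp.memLp φ)

theorem norm_integral_smul_Lp_le [IsFiniteMeasureOnCompacts m] (h : C_c(K, ℝ)) (φ : Lp ℂ ∞ m) :
    ‖∫ y, h y • φ y ∂m‖ ≤ ‖φ‖ * ∫ y, |h y| ∂m := by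
  rw [← integral_const_mul]
  refine norm_integral_le_of_norm_le (h.integrable.abs.const_mul _) ?_
  filter_upwards [ae_norm_le_norm_Lp φ] with y hy
  rw [norm_smul, Real.norm_eq_abs, mul_comm]
  exact mul_le_mul_of_nonneg_right hy (abs_nonneg _)

end Linfty

section BoundedContinuous

variable {K : Type*} [TopologicalSpace K] [MeasurableSpace K] [BorelSpace K] [Hypergroup K]

theorem translate_e {f : K → ℂ} (hf : Continuous f) : translate e f = f :=
  funext fun y => by rw [translate, e_conv, integral_dirac' _ _ hf.stronglyMeasurable]

theorem Dual.apply_e (α : Dual K) : α.1 e = 1 := by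
  obtain ⟨x, hx⟩ := DFunLike.ne_iff.mp α.2.1
  have h := α.2.2.2.1 x e
  rw [integral_conv_e x α.1.continuous.stronglyMeasurable] at h
  exact mul_left_cancel₀ hx (h.symm.trans (mul_one _).symm)

variable [T2Space K] [LocallyCompactSpace K]

theorem continuous_integral_conv_complex {P : Type*} [TopologicalSpace P] {a b : P → K}
    (ha : Continuous a) (hb : Continuous b) {G : P → K → ℂ} (hG : Continuous G.uncurry) :
    Continuous fun p => ∫ s, G p s ∂(conv (a p) (b p)) := by
  have re_add_im : ∀ p, ∫ s, G p s ∂(conv (a p) (b p)) =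
      ((∫ s, (G p s).re ∂(conv (a p) (b p)) : ℝ) : ℂ) +
        ((∫ s, (G p s).im ∂(conv (a p) (b p)) : ℝ) : ℂ) * Complex.I := fun p =>
    (integral_re_add_im (integrable_conv (a p) (b p) (hG.comp (Continuous.prodMk_right p)))).symm
  have h_re := continuous_integral_conv ha hb (G := fun p s => (G p s).re)
    (Complex.continuous_re.comp hG)
  have h_im := continuous_integral_conv ha hb (G := fun p s => (G p s).im)
    (Complex.continuous_im.comp hG)
  simp_rw [re_add_im]
  fun_prop

theorem continuous_translate (x : K) {f : K → ℂ} (hf : Continuous f) :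
    Continuous (translate x f) :=
  continuous_integral_conv_complex continuous_const continuous_id (G := fun _ s => f s)
    (hf.comp continuous_snd)

/-- The translation `T_x` as a bounded operator on the bounded continuous functions. -/
def translateBCF (x : K) : (K →ᵇ ℂ) →L[ℂ] (K →ᵇ ℂ) :=
  LinearMap.mkContinuous
    { toFun := fun f => BoundedContinuousFunction.ofNormedAddCommGroup (translate x f)
        (continuous_translate x f.continuous) ‖f‖ (norm_translate_le x f.norm_coe_le_norm)
      map_add' := fun f g => BoundedContinuousFunction.ext fun y =>
        integral_add (integrable_conv x y f.continuous) (integrable_conv x y g.continuous)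
      map_smul' := fun c _ => BoundedContinuousFunction.ext fun _ => integral_const_mul c _ }
    1 fun f => (one_mul ‖f‖).symm ▸ BoundedContinuousFunction.norm_ofNormedAddCommGroup_le _
      (norm_nonneg f) (norm_translate_le x f.norm_coe_le_norm)

/-- The embedding of the bounded continuous functions into `L^∞`. -/
def bcfToLinfty (m : Measure K) : (K →ᵇ ℂ) →L[ℂ] Lp ℂ ∞ m :=
  LinearMap.mkContinuous
    { toFun := fun f => toLinfty m f f.continuous.measurable ⟨_, f.norm_coe_le_norm⟩
      map_add' := fun _ _ => rfl
      map_smul' := fun _ _ => rfl }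
    1 fun f => by
      refine (Lp.norm_toLp f (memLp_top_of_bounded m f.continuous.measurable
        f.norm_coe_le_norm)).trans_le ?_
      rw [one_mul]
      refine ENNReal.toReal_le_of_le_ofReal (norm_nonneg f) ?_
      rw [eLpNorm_exponent_top]
      exact eLpNormEssSup_le_of_ae_bound (.of_forall f.norm_coe_le_norm)

/-- A character as a bounded continuous function. -/
def Dual.toBCF (α : Dual K) : K →ᵇ ℂ :=
  BoundedContinuousFunction.ofNormedAddCommGroup α.1 α.1.continuous _ α.2.2.1.choose_spec

theorem IsAmenableAt.exists_functional {m : Measure K} {α : Dual K} (h : IsAmenableAt m α) :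
    ∃ N : StrongDual ℂ (K →ᵇ ℂ), N α.toBCF = 1 ∧ ∀ x f, N (translateBCF x f) = α.1 x * N f := by
  obtain ⟨M, hM_one, hM⟩ := h
  exact ⟨M.comp (bcfToLinfty m), hM_one,
    fun x f => hM x f f.continuous.measurable ⟨_, f.norm_coe_le_norm⟩⟩

end BoundedContinuous

section Smoothing

variable {K : Type*} [TopologicalSpace K] [T2Space K] [LocallyCompactSpace K]
  [MeasurableSpace K] [BorelSpace K] [Hypergroup K] {m : Measure K}

theorem smooth_congr_ae {E : Type*} [NormedAddCommGroup E] [NormedSpace ℝ E] (F : C_c(K, ℝ))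
    {φ ψ : K → E} (h : φ =ᵐ[m] ψ) : smooth m F φ = smooth m F ψ :=
  funext fun _ => integral_congr_ae (h.mono fun _ hy => congrArg (_ • ·) hy)

theorem IsHaarMeasure.integral_abs_ccTranslate_le (hm : IsHaarMeasure m) (x : K)
    (h : C_c(K, ℝ)) : ∫ y, |ccTranslate x h y| ∂m ≤ ∫ y, |h y| ∂m := by
  have := hm.isFiniteMeasureOnCompacts
  let habs : C_c(K, ℝ) := ⟨⟨fun y => |h y|, (map_continuous h).abs⟩, h.hasCompactSupport.abs⟩
  calc ∫ y, |ccTranslate x h y| ∂m ≤ ∫ y, ccTranslate x habs y ∂m :=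
        integral_mono (ccTranslate x h).integrable.abs (ccTranslate x habs).integrable
          fun _ => abs_integral_le_integral_abs
    _ = ∫ y, |h y| ∂m := hm.integral_ccTranslate x habs

theorem IsHaarMeasure.norm_smooth_le (hm : IsHaarMeasure m) (F : C_c(K, ℝ)) (φ : Lp ℂ ∞ m)
    (x : K) : ‖smooth m F φ x‖ ≤ (∫ y, |F y| ∂m) * ‖φ‖ := by
  have := hm.isFiniteMeasureOnCompacts
  rw [mul_comm]
  exact (norm_integral_smul_Lp_le _ φ).trans
    (mul_le_mul_of_nonneg_left (hm.integral_abs_ccTranslate_le _ F) (norm_nonneg _))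

/-- Smoothing as a bounded operator from `L^∞` to the bounded continuous functions. -/
def smoothCLM (hm : IsHaarMeasure m) (F : C_c(K, ℝ)) : Lp ℂ ∞ m →L[ℂ] (K →ᵇ ℂ) :=
  have := hm.isFiniteMeasureOnCompacts
  LinearMap.mkContinuous
    { toFun := fun φ => BoundedContinuousFunction.ofNormedAddCommGroup (smooth m F φ)
        (continuous_smooth F ((Lp.memLp φ).locallyIntegrable le_top)) _ (hm.norm_smooth_le F φ)
      map_add' := fun φ ψ => BoundedContinuousFunction.ext fun x => by
        refine (congrFun (smooth_congr_ae F (Lp.coeFn_add φ ψ)) x).trans ?_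
        simp only [smooth, Pi.add_apply, smul_add]
        exact integral_add (integrable_smul_Lp _ φ) (integrable_smul_Lp _ ψ)
      map_smul' := fun c φ => BoundedContinuousFunction.ext fun x => by
        refine (congrFun (smooth_congr_ae F (Lp.coeFn_smul c φ)) x).trans ?_
        simp only [smooth, Pi.smul_apply, smul_comm _ c]
        exact integral_smul c _ }
    (∫ y, |F y| ∂m) fun φ => BoundedContinuousFunction.norm_ofNormedAddCommGroup_le _
      (mul_nonneg (integral_nonneg fun _ => abs_nonneg _) (norm_nonneg φ)) (hm.norm_smooth_le F φ)

theorem smoothCLM_toLinfty (hm : IsHaarMeasure m) (F : C_c(K, ℝ)) {φ : K → ℂ} (hφ : Measurable φ)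
    (hb : ∃ C : ℝ, ∀ t, ‖φ t‖ ≤ C) : ⇑(smoothCLM hm F (toLinfty m φ hφ hb)) = smooth m F φ :=
  smooth_congr_ae F (MemLp.coeFn_toLp _)

theorem IsHaarMeasure.smooth_translate (hm : IsHaarMeasure m) {F : C_c(K, ℝ)}
    (hF : ∀ t, 0 ≤ F t) (z : K) {φ : K → ℂ} (hφ : Measurable φ) {C : ℝ} (hC : ∀ t, ‖φ t‖ ≤ C) :
    smooth m F (translate z φ) = translate z (smooth m F φ) := by
  have := hm.isFiniteMeasureOnCompacts
  ext x
  exact (hm.integral_smul_translate z (ccTranslate_nonneg hF _) hφ hC).trans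
    (integral_smooth_conv F ((memLp_top_of_bounded m hφ hC).locallyIntegrable le_top) z x).symm

theorem IsHaarMeasure.smooth_char (hm : IsHaarMeasure m) {F : C_c(K, ℝ)} (hF : ∀ t, 0 ≤ F t)
    (γ : Dual K) (x : K) : smooth m F γ.1 x = γ.1 x * smooth m F γ.1 e := by
  have := hm.isFiniteMeasureOnCompacts
  have hγ : translate x γ.1 = fun y => γ.1 x * γ.1 y := funext (γ.2.2.2.1 x)
  calc smooth m F γ.1 x = translate x (smooth m F γ.1) e :=
        (integral_conv_e x
          (continuous_smooth F γ.1.continuous.locallyIntegrable).stronglyMeasurable).symm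
    _ = smooth m F (fun y => γ.1 x * γ.1 y) e := by
        rw [← hγ, hm.smooth_translate hF x γ.1.continuous.measurable γ.2.2.1.choose_spec]
    _ = γ.1 x * smooth m F γ.1 e := by
        rw [smooth, smooth, ← integral_const_mul]
        exact integral_congr_ae (.of_forall fun _ => (mul_smul_comm _ _ _).symm)

theorem IsHaarMeasure.exists_smooth_char_e_ne_zero (hm : IsHaarMeasure m) (γ : Dual K) :
    ∃ F : C_c(K, ℝ), (∀ t, 0 ≤ F t) ∧ smooth m F γ.1 e ≠ 0 := by
  obtain ⟨U, hU, heU, h⟩ := hm.exists_isOpen_norm_smooth_sub_le γ.1.continuous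
    (isCompact_singleton (x := e)) one_half_pos
  obtain ⟨F, hF_nonneg, hFU, hF_one, -⟩ := hm.exists_symmetric_bump_integral_eq_one hU heU
  refine ⟨F, hF_nonneg, fun h_zero => ?_⟩
  have h_le := h F hF_nonneg hFU hF_one e rfl
  rw [h_zero, γ.apply_e] at h_le
  norm_num at h_le

theorem IsHaarMeasure.isAmenableAt_of_smoothCLM_mem (hm : IsHaarMeasure m) (γ : Dual K)
    (V : Submodule ℂ (K →ᵇ ℂ)) (hV : ∀ F φ, smoothCLM hm F φ ∈ V) (hγ : γ.toBCF ∈ V)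
    (N : V →L[ℂ] ℂ) (hN : N ⟨_, hγ⟩ = 1)
    (hN_translate : ∀ (x : K) (f g : V), (g : K →ᵇ ℂ) = translateBCF x f → N g = γ.1 x * N f) :
    IsAmenableAt m γ := by
  obtain ⟨F, hF_nonneg, hF⟩ := hm.exists_smooth_char_e_ne_zero γ
  let S : Lp ℂ ∞ m →L[ℂ] V := (smoothCLM hm F).codRestrict V (hV F)
  have hS_char : S (toLinfty m γ.1 γ.1.continuous.measurable γ.2.2.1) =
      smooth m F γ.1 e • ⟨_, hγ⟩ := by
    ext x
    refine (congrFun (smoothCLM_toLinfty hm F _ _) x).trans ?_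
    rw [hm.smooth_char hF_nonneg, mul_comm]
    rfl
  refine ⟨(smooth m F γ.1 e)⁻¹ • N.comp S, ?_, fun x φ hφ hb => ?_⟩
  · rw [smul_apply, ContinuousLinearMap.comp_apply, hS_char, map_smul, hN,
      smul_eq_mul, smul_eq_mul, mul_one, inv_mul_cancel₀ hF]
  · obtain ⟨C, hC⟩ := id hb
    have hS_translate : smoothCLM hm F (toLinfty m (translate x φ) (measurable_translate x hφ)
        (hb.imp fun _ hC => norm_translate_le x hC)) =
        translateBCF x (smoothCLM hm F (toLinfty m φ hφ hb)) := by
      refine DFunLike.coe_injective ?_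
      rw [smoothCLM_toLinfty, hm.smooth_translate hF_nonneg x hφ hC,
        ← smoothCLM_toLinfty hm F hφ hb]
      rfl
    simp only [smul_apply, ContinuousLinearMap.comp_apply, smul_eq_mul]
    rw [hN_translate x (S (toLinfty m φ hφ hb)) (S _) hS_translate, mul_left_comm]

theorem IsHaarMeasure.isAmenableAt_iff_exists_functional (hm : IsHaarMeasure m) (γ : Dual K) :
    IsAmenableAt m γ ↔ ∃ N : StrongDual ℂ (K →ᵇ ℂ), N γ.toBCF = 1 ∧
      ∀ x f, N (translateBCF x f) = γ.1 x * N f := by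
  refine ⟨IsAmenableAt.exists_functional, fun ⟨N, hN, hN_translate⟩ => ?_⟩
  refine hm.isAmenableAt_of_smoothCLM_mem γ ⊤ (fun _ _ => Submodule.mem_top) Submodule.mem_top
    (N.comp (Submodule.subtypeL ⊤)) hN fun x f g hfg => ?_
  exact (congrArg N hfg).trans (hN_translate x f)

end Smoothing

end Hypergroup

/-! ### Products -/

namespace Hypergroup

section SmoothingContinuity

variable {K : Type*} [TopologicalSpace K] [T2Space K] [LocallyCompactSpace K]
  [MeasurableSpace K] [BorelSpace K] [Hypergroup K] {m : Measure K}

theorem integrable_conv_of_continuous {E : Type*} [NormedAddCommGroup E] {f : K → E}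
    (hf : Continuous f) (x y : K) : Integrable f (conv x y) := by
  have h := hf.continuousOn.integrableOn_compact (μ := conv x y) (isCompact_support_conv x y)
  rwa [IntegrableOn, Measure.restrict_eq_self_of_ae_mem (ae_mem_support (conv x y))] at h

theorem ccTranslate_sub (x : K) (f g : C_c(K, ℝ)) :
    ccTranslate x (f - g) = ccTranslate x f - ccTranslate x g := by
  ext y
  exact integral_sub (integrable_conv x y (map_continuous f))
    (integrable_conv x y (map_continuous g))

theorem ccTranslate_of_conv_eq_dirac {p q r : K} (h : conv p q = Measure.dirac r)
    (F : C_c(K, ℝ)) : ccTranslate r F = ccTranslate q (ccTranslate p F) := by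
  ext z
  rw [ccTranslate_ccTranslate, h, integral_dirac' (fun t => ccTranslate t F z) _
    ((continuous_ccTranslate F).comp (Continuous.prodMk_left z)).stronglyMeasurable]

theorem continuous_integral_abs_ccTranslate_sub [IsFiniteMeasureOnCompacts m] (F G : C_c(K, ℝ)) :
    Continuous fun x => ∫ y, |(ccTranslate x F - G) y| ∂m := by
  refine continuous_iff_continuousAt.mpr fun x => ?_
  obtain ⟨C, hC, hxC⟩ := exists_compact_mem_nhds x
  obtain ⟨D, hD, hFD⟩ := exists_isCompact_ccTranslate_eq_zero hC F
  refine (continuousOn_integral_of_compact_support (s := C)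
    (f := fun x y => |(ccTranslate x F - G) y|) (hD.union G.hasCompactSupport.isCompact)
    ((continuous_ccTranslate F).sub ((map_continuous G).comp continuous_snd)).abs.continuousOn
    fun x y hx hy => ?_).continuousAt hxC
  rw [CompactlySupportedContinuousMap.sub_apply, hFD x hx y fun h => hy (.inl h),
    image_eq_zero_of_notMem_tsupport fun h => hy (.inr h), sub_zero, abs_zero]

-- The bound does not depend on `q`, which makes it uniform along the slices of a product.
theorem IsHaarMeasure.norm_smooth_sub_le (hm : IsHaarMeasure m) (F : C_c(K, ℝ)) (φ : Lp ℂ ∞ m)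
    {p p' q r r' : K} (h : conv p q = Measure.dirac (inv r))
    (h' : conv p' q = Measure.dirac (inv r')) :
    ‖smooth m F φ r - smooth m F φ r'‖ ≤
      ‖φ‖ * ∫ y, |(ccTranslate p F - ccTranslate p' F) y| ∂m := by
  have := hm.isFiniteMeasureOnCompacts
  have h_sub : smooth m F φ r - smooth m F φ r' =
      ∫ y, ccTranslate q (ccTranslate p F - ccTranslate p' F) y • φ y ∂m := by
    simp only [ccTranslate_sub, ← ccTranslate_of_conv_eq_dirac h,
      ← ccTranslate_of_conv_eq_dirac h', CompactlySupportedContinuousMap.sub_apply, sub_smul]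
    exact (integral_sub (integrable_smul_Lp _ φ) (integrable_smul_Lp _ φ)).symm
  rw [h_sub]
  exact (norm_integral_smul_Lp_le _ φ).trans
    (mul_le_mul_of_nonneg_left (hm.integral_abs_ccTranslate_le q _) (norm_nonneg φ))

end SmoothingContinuity

section Intertwining

variable {K G : Type*} [TopologicalSpace K] [T2Space K] [LocallyCompactSpace K]
  [MeasurableSpace K] [BorelSpace K] [TopologicalSpace G] [T2Space G] [LocallyCompactSpace G]
  [MeasurableSpace G] [BorelSpace G] [Hypergroup K] [Hypergroup G]

theorem IsAmenableAt.of_intertwining {mK : Measure K} (hK : IsHaarMeasure mK) {mG : Measure G}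
    {α : Dual K} {γ : Dual G} (hγ : IsAmenableAt mG γ) {ι : K → G} (hι : ∀ x, γ.1 (ι x) = α.1 x)
    {Φ : (K →ᵇ ℂ) →L[ℂ] (G →ᵇ ℂ)} (hΦ : Φ α.toBCF = γ.toBCF)
    (hΦ_translate : ∀ x f, translateBCF (ι x) (Φ f) = Φ (translateBCF x f)) :
    IsAmenableAt mK α := by
  obtain ⟨N, hN, hN_translate⟩ := hγ.exists_functional
  refine (hK.isAmenableAt_iff_exists_functional α).mpr ⟨N.comp Φ, ?_, fun x f => ?_⟩
  · rw [ContinuousLinearMap.comp_apply, hΦ, hN]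
  · rw [ContinuousLinearMap.comp_apply, ContinuousLinearMap.comp_apply, ← hΦ_translate,
      hN_translate, hι]

/-- The pullback of a character along a map of hypergroups that respects the identity, the
involution and the convolution of point masses. -/
def Dual.comap (γ : Dual G) (ι : C(K, G)) (hι_e : ι e = e) (hι_inv : ∀ x, ι (inv x) = inv (ι x))
    (hι_conv : ∀ x y, ∫ t, γ.1 t ∂(conv (ι x) (ι y)) = ∫ t, γ.1 (ι t) ∂(conv x y)) : Dual K :=
  ⟨γ.1.comp ι,
    fun h => one_ne_zero
      (γ.apply_e.symm.trans ((congrArg γ.1 hι_e).symm.trans (DFunLike.congr_fun h e))),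
    γ.2.2.1.imp fun _ hC _ => hC _,
    fun x y => (hι_conv x y).symm.trans (γ.2.2.2.1 (ι x) (ι y)),
    fun x => (congrArg γ.1 (hι_inv x)).trans (γ.2.2.2.2 (ι x))⟩

end Intertwining

section Slices

variable {K H : Type*} [TopologicalSpace K] [TopologicalSpace H]

/-- The slice `f(x, ·)`. -/
def slice (f : K × H →ᵇ ℂ) (x : K) : H →ᵇ ℂ :=
  f.compContinuous ⟨fun y => (x, y), by fun_prop⟩

variable (K H) in
/-- The bounded continuous functions on `K × H` whose slices depend norm continuously on the first
coordinate. -/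
def sliceContinuous : Submodule ℂ (K × H →ᵇ ℂ) where
  carrier := {f | Continuous (slice f)}
  add_mem' hf hg := hf.add hg
  zero_mem' := (continuous_const : Continuous fun _ : K => (0 : H →ᵇ ℂ))
  smul_mem' c _ hf := hf.const_smul c

/-- The map `f ↦ (x ↦ f(x, ·))` as a bounded operator. -/
def sliceCLM : sliceContinuous K H →L[ℂ] (K →ᵇ H →ᵇ ℂ) :=
  LinearMap.mkContinuous
    { toFun := fun f => BoundedContinuousFunction.ofNormedAddCommGroup (slice f.1) f.2 ‖f‖
        fun _ => f.1.norm_compContinuous_le _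
      map_add' := fun _ _ => rfl
      map_smul' := fun _ _ => rfl }
    1 fun f => (one_mul ‖f‖).symm ▸ BoundedContinuousFunction.norm_ofNormedAddCommGroup_le _
      (norm_nonneg f) fun _ => f.1.norm_compContinuous_le _

/-- The map `f ↦ (x ↦ N(f(x, ·)))`. -/
def sliceFunctional (N : StrongDual ℂ (H →ᵇ ℂ)) : sliceContinuous K H →L[ℂ] (K →ᵇ ℂ) :=
  (N.compLeftContinuousBounded K).comp sliceCLM

theorem sliceFunctional_apply (N : StrongDual ℂ (H →ᵇ ℂ)) (f : sliceContinuous K H) (x : K) :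
    sliceFunctional N f x = N (slice f.1 x) := rfl

end Slices

variable {K H : Type*} [TopologicalSpace K] [T2Space K] [LocallyCompactSpace K]
  [MeasurableSpace K] [BorelSpace K] [TopologicalSpace H] [T2Space H] [LocallyCompactSpace H]
  [MeasurableSpace H] [BorelSpace H] [MeasurableSpace (K × H)] [BorelSpace (K × H)]
  [Hypergroup K] [Hypergroup H]

section ProductDual

theorem integral_conv_prod (x y : K) (x' y' : H) {f : K × H → ℂ} (hf : Continuous f) :
    ∫ p, f p ∂(conv (x, x') (y, y')) = ∫ s, ∫ t, f (s, t) ∂(conv x' y') ∂(conv x y) := by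
  have h_inner : Continuous fun s => ∫ t, f (s, t) ∂(conv x' y') :=
    continuous_integral_conv_complex continuous_const continuous_const
      (G := fun s t => f (s, t)) hf
  have h_comp : ∀ L : ℂ →L[ℝ] ℝ, L (∫ p, f p ∂(conv (x, x') (y, y'))) =
      L (∫ s, ∫ t, f (s, t) ∂(conv x' y') ∂(conv x y)) := by
    intro L
    rw [← L.integral_comp_comm (integrable_conv _ _ hf),
      ← L.integral_comp_comm (integrable_conv _ _ h_inner)]
    refine (integral_prodConv x y x' y' (L.continuous.comp hf)).trans ?_
    exact integral_congr_ae (.of_forall fun s =>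
      L.integral_comp_comm (integrable_conv x' y' (hf.comp (Continuous.prodMk_right s))))
  exact Complex.ext (h_comp Complex.reCLM) (h_comp Complex.imCLM)

theorem conv_left_right (x : K) (y : H) :
    conv ((x, e) : K × H) (e, y) = Measure.dirac (x, y) :=
  prodConv_eq_dirac (conv_e x) (e_conv y)

/-- The restriction of a character of `K × H` to `K`. -/
def Dual.restrictLeft (γ : Dual (K × H)) : Dual K :=
  γ.comap ⟨fun x => (x, e), by fun_prop⟩ rfl (fun _ => Prod.ext rfl inv_e.symm) fun x y =>
    (integral_conv_prod x y e e γ.1.continuous).trans (integral_congr_ae (.of_forall fun s =>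
      integral_conv_e (e : H)
        (γ.1.continuous.comp (Continuous.prodMk_right s)).stronglyMeasurable))

/-- The restriction of a character of `K × H` to `H`. -/
def Dual.restrictRight (γ : Dual (K × H)) : Dual H :=
  γ.comap ⟨fun y => (e, y), by fun_prop⟩ rfl (fun _ => Prod.ext inv_e.symm rfl) fun x y =>
    (integral_conv_prod e e x y γ.1.continuous).trans
      (integral_conv_e (e : K) (continuous_integral_conv_complex continuous_const continuous_const
        (G := fun s t => γ.1 (s, t)) γ.1.continuous).stronglyMeasurable)

theorem Dual.apply_prod (γ : Dual (K × H)) (x : K) (y : H) :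
    γ.1 (x, y) = γ.1 (x, e) * γ.1 (e, y) := by
  rw [← γ.2.2.2.1, conv_left_right, integral_dirac' _ _ γ.1.continuous.stronglyMeasurable]

variable (K H) in
/-- The dual of a product is the product of the duals. -/
def dualProdHomeomorph : Dual K × Dual H ≃ₜ Dual (K × H) where
  toFun p := tensor p.1 p.2
  invFun γ := (γ.restrictLeft, γ.restrictRight)
  left_inv := fun (α, β) => Prod.ext
    (Subtype.ext (ContinuousMap.ext fun x =>
      show α.1 x * β.1 e = α.1 x by rw [β.apply_e, mul_one]))
    (Subtype.ext (ContinuousMap.ext fun y =>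
      show α.1 e * β.1 y = β.1 y by rw [α.apply_e, one_mul]))
  right_inv γ := Subtype.ext (ContinuousMap.ext fun p => (γ.apply_prod p.1 p.2).symm)
  continuous_toFun := by
    have h_fst : Continuous fun p : Dual K × Dual H =>
        p.1.1.comp (⟨Prod.fst, continuous_fst⟩ : C(K × H, K)) :=
      (ContinuousMap.continuous_precomp _).comp (continuous_subtype_val.comp continuous_fst)
    have h_snd : Continuous fun p : Dual K × Dual H =>
        p.2.1.comp (⟨Prod.snd, continuous_snd⟩ : C(K × H, H)) :=
      (ContinuousMap.continuous_precomp _).comp (continuous_subtype_val.comp continuous_snd)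
    exact (h_fst.mul h_snd).subtype_mk _
  continuous_invFun :=
    (((ContinuousMap.continuous_precomp _).comp continuous_subtype_val).subtype_mk _).prodMk
      (((ContinuousMap.continuous_precomp _).comp continuous_subtype_val).subtype_mk _)

end ProductDual

section ProductAmenable

variable (K H) in
/-- The bilinear map `(f, g) ↦ f ⊗ g` on bounded continuous functions. -/
def bcfTensor : (K →ᵇ ℂ) →L[ℂ] (H →ᵇ ℂ) →L[ℂ] (K × H →ᵇ ℂ) :=
  (ContinuousLinearMap.mul ℂ (K × H →ᵇ ℂ)).bilinearComp
    (BoundedContinuousFunction.compContinuousCLM ℂ ℂ ⟨Prod.fst, continuous_fst⟩)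
    (BoundedContinuousFunction.compContinuousCLM ℂ ℂ ⟨Prod.snd, continuous_snd⟩)

theorem translateBCF_e (f : K →ᵇ ℂ) : translateBCF e f = f :=
  DFunLike.coe_injective (translate_e f.continuous)

theorem translateBCF_bcfTensor (x : K) (y : H) (f : K →ᵇ ℂ) (g : H →ᵇ ℂ) :
    translateBCF (x, y) (bcfTensor K H f g) =
      bcfTensor K H (translateBCF x f) (translateBCF y g) :=
  BoundedContinuousFunction.ext fun p =>
    integral_tensor x p.1 y p.2 f.continuous g.continuous

theorem IsAmenableAt.left {mK : Measure K} (hK : IsHaarMeasure mK) {mKH : Measure (K × H)}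
    {α : Dual K} {β : Dual H} (h : IsAmenableAt mKH (tensor α β)) : IsAmenableAt mK α :=
  .of_intertwining hK h (ι := fun x => (x, e)) (Φ := (bcfTensor K H).flip β.toBCF)
    (fun x => show α.1 x * β.1 e = α.1 x by rw [β.apply_e, mul_one]) rfl fun x f =>
      (translateBCF_bcfTensor x e f β.toBCF).trans (by rw [translateBCF_e]; rfl)

theorem IsAmenableAt.right {mH : Measure H} (hH : IsHaarMeasure mH) {mKH : Measure (K × H)}
    {α : Dual K} {β : Dual H} (h : IsAmenableAt mKH (tensor α β)) : IsAmenableAt mH β :=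
  .of_intertwining hH h (ι := fun y => (e, y)) (Φ := bcfTensor K H α.toBCF)
    (fun y => show α.1 e * β.1 y = β.1 y by rw [α.apply_e, one_mul]) rfl fun y g =>
      (translateBCF_bcfTensor e y α.toBCF g).trans (by rw [translateBCF_e])

theorem smoothCLM_mem_sliceContinuous {m : Measure (K × H)} (hm : IsHaarMeasure m)
    (F : C_c(K × H, ℝ)) (φ : Lp ℂ ∞ m) : smoothCLM hm F φ ∈ sliceContinuous K H := by
  have := hm.isFiniteMeasureOnCompacts
  refine continuous_iff_continuousAt.mpr fun x₀ => ?_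
  let d : K → ℝ := fun x => ∫ y, |(ccTranslate ((inv x, e) : K × H) F -
    ccTranslate (inv x₀, e) F) y| ∂m
  have hd : Continuous d := (continuous_integral_abs_ccTranslate_sub F _).comp
    (continuous_inv.prodMk continuous_const)
  have hd_zero : d x₀ = 0 := by
    simp only [d, sub_self, CompactlySupportedContinuousMap.zero_apply, abs_zero, integral_zero]
  have h_le : ∀ x, ‖slice (smoothCLM hm F φ) x - slice (smoothCLM hm F φ) x₀‖ ≤ ‖φ‖ * d x := by
    refine fun x => (BoundedContinuousFunction.norm_le (mul_nonneg (norm_nonneg φ)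
      (integral_nonneg fun _ => abs_nonneg _))).mpr fun y => ?_
    exact hm.norm_smooth_sub_le F φ (r := (x, y)) (r' := (x₀, y)) (q := (e, inv y))
      (conv_left_right _ _) (conv_left_right _ _)
  refine tendsto_iff_norm_sub_tendsto_zero.mpr
    (squeeze_zero (fun _ => norm_nonneg _) h_le ?_)
  simpa only [hd_zero, mul_zero] using (hd.tendsto x₀).const_mul ‖φ‖

theorem slice_translateBCF {f : K × H →ᵇ ℂ} (hf : Continuous (slice f)) (x s : K) (y : H) :
    slice (translateBCF (x, y) f) s = translateBCF y (∫ u, slice f u ∂(conv x s)) := by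
  have h_int := integrable_conv_of_continuous hf x s
  ext t
  rw [← (translateBCF y).integral_comp_comm h_int]
  exact (integral_conv_prod x s y t f.continuous).trans
    ((BoundedContinuousFunction.evalCLM ℂ t).integral_comp_comm
      ((translateBCF y).integrable_comp h_int))

theorem sliceFunctional_of_eq_translateBCF {N : StrongDual ℂ (H →ᵇ ℂ)} {β : Dual H}
    (hN : ∀ y g, N (translateBCF y g) = β.1 y * N g) (x : K) (y : H) {f g : sliceContinuous K H}
    (hg : (g : K × H →ᵇ ℂ) = translateBCF (x, y) f) :
    sliceFunctional N g = β.1 y • translateBCF x (sliceFunctional N f) := by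
  ext s
  rw [sliceFunctional_apply, hg, slice_translateBCF f.2, hN,
    ← N.integral_comp_comm (integrable_conv_of_continuous f.2 x s)]
  rfl

theorem slice_toBCF_tensor (α : Dual K) (β : Dual H) (x : K) :
    slice (tensor α β).toBCF x = α.1 x • β.toBCF := rfl

theorem toBCF_tensor_mem_sliceContinuous (α : Dual K) (β : Dual H) :
    (tensor α β).toBCF ∈ sliceContinuous K H :=
  (α.1.continuous.smul continuous_const : Continuous fun x => α.1 x • β.toBCF)

theorem IsAmenableAt.tensor {mK : Measure K} {mH : Measure H} {mKH : Measure (K × H)}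
    (hm : IsHaarMeasure mKH) {α : Dual K} {β : Dual H} (hα : IsAmenableAt mK α)
    (hβ : IsAmenableAt mH β) : IsAmenableAt mKH (Hypergroup.tensor α β) := by
  obtain ⟨M, hM, hM_translate⟩ := hα.exists_functional
  obtain ⟨N, hN, hN_translate⟩ := hβ.exists_functional
  have h_char : sliceFunctional N ⟨_, toBCF_tensor_mem_sliceContinuous α β⟩ = α.toBCF := by
    ext x
    rw [sliceFunctional_apply, slice_toBCF_tensor, map_smul, hN, smul_eq_mul, mul_one]
    rfl
  refine hm.isAmenableAt_of_smoothCLM_mem _ (sliceContinuous K H)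
    (smoothCLM_mem_sliceContinuous hm) (toBCF_tensor_mem_sliceContinuous α β)
    (M.comp (sliceFunctional N)) ?_ ?_
  · rw [ContinuousLinearMap.comp_apply, h_char, hM]
  · rintro ⟨x, y⟩ f g hg
    have h_tensor : (Hypergroup.tensor α β).1 (x, y) = α.1 x * β.1 y := rfl
    rw [ContinuousLinearMap.comp_apply, ContinuousLinearMap.comp_apply, h_tensor,
      sliceFunctional_of_eq_translateBCF hN_translate x y hg, map_smul, hM_translate,
      smul_eq_mul, mul_left_comm, mul_assoc]

end ProductAmenable

end Hypergroup

end

theorem mainTheorem5_general {K H : Type*}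
    [TopologicalSpace K] [T2Space K] [LocallyCompactSpace K] [MeasurableSpace K] [BorelSpace K]
    [TopologicalSpace H] [T2Space H] [LocallyCompactSpace H] [MeasurableSpace H] [BorelSpace H]
    [MeasurableSpace (K × H)] [BorelSpace (K × H)]
    [Hypergroup K] [Hypergroup H] :
    IsHomeomorph (fun p : Hypergroup.Dual K × Hypergroup.Dual H => Hypergroup.tensor p.1 p.2) ∧
    ∀ (mK : Measure K) (mH : Measure H) (mKH : Measure (K × H)),
      Hypergroup.IsHaarMeasure mK → Hypergroup.IsHaarMeasure mH → Hypergroup.IsHaarMeasure mKH →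
      ∀ (α : Hypergroup.Dual K) (β : Hypergroup.Dual H),
        Hypergroup.IsAmenableAt mKH (Hypergroup.tensor α β) ↔
          Hypergroup.IsAmenableAt mK α ∧ Hypergroup.IsAmenableAt mH β :=
  ⟨(Hypergroup.dualProdHomeomorph K H).isHomeomorph, fun _ _ _ hK hH hKH _ _ =>
    ⟨fun h => ⟨h.left hK, h.right hH⟩, fun h => h.1.tensor hKH h.2⟩⟩

theorem mainTheorem5 {K H : Type*}
    [TopologicalSpace K] [T2Space K] [LocallyCompactSpace K] [MeasurableSpace K] [BorelSpace K]
    [TopologicalSpace H] [T2Space H] [LocallyCompactSpace H] [MeasurableSpace H] [BorelSpace H]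
    [MeasurableSpace (K × H)] [BorelSpace (K × H)]
    [CommHypergroup K] [CommHypergroup H] :
    IsHomeomorph (fun p : Hypergroup.Dual K × Hypergroup.Dual H => Hypergroup.tensor p.1 p.2) ∧
    ∀ (mK : Measure K) (mH : Measure H) (mKH : Measure (K × H)),
      Hypergroup.IsHaarMeasure mK → Hypergroup.IsHaarMeasure mH → Hypergroup.IsHaarMeasure mKH →
      ∀ (α : Hypergroup.Dual K) (β : Hypergroup.Dual H),
        Hypergroup.IsAmenableAt mKH (Hypergroup.tensor α β) ↔
          Hypergroup.IsAmenableAt mK α ∧ Hypergroup.IsAmenableAt mH β :=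
  mainTheorem5_general
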